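/- Let $\mu$ be a non-atomic Borel probability measure on $[0,1]$ with distribution function $F(x)=\mu([0,x])$. The Krein–Feller operator $\frac{d}{d\mu}\frac{d}{dx}$ maps $f$ to $(f')^\mu$. Its domain consists of all $f\in C^1([0,1])$ for which there is $(f')^\mu\in L_2([0,1],\mu)$ with $f'(x)=f'(0)+\int_0^x (f')^\mu\,d\mu$ for all $x\in[0,1]$. Let $\lambda_{N,0}<\lambda_{N,1}<\dots$ be its Neumann eigenvalues, i.e. the real $\lambda$ for which $\frac{d}{d\mu}\frac{d}{dx}f=-\lambda f$ has a solution $f\not\equiv 0$ with $f'(0)=f'(1)=0$. Let $\lambda_{D,1}<\lambda_{D,2}<\dots$ be its Dirichlet eigenvalues, defined in the same way with $f(0)=f(1)=0$. Put $p_0=q_0=1$ and, for $n\ge 1$, $$p_n(x)=\begin{cases}\int_0^x p_{n-1}\,d\mu,& n \text{ odd},\\ \int_0^x p_{n-1}(t)\,dt,& n\text{ even},\end{cases}\qquad q_n(x)=\begin{cases}\int_0^x q_{n-1}(t)\,dt,& n \text{ odd},\\ \int_0^x q_{n-1}\,d\mu,& n\text{ even},\end{cases}$$ $$\mathrm{cp}_z(x)=\sum_{n\ge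 0}(-1)^n z^{2n}p_{2n}(x),\qquad \mathrm{sq}_z(x)=\sum_{n\ge 0}(-1)^n z^{2n+1}q_{2n+1}(x),$$ and let $f_{N,m}=\mathrm{cp}_{\sqrt{\lambda_{N,m}}}$ $(m\ge 0)$ and $f_{D,m}=\mathrm{sq}_{\sqrt{\lambda_{D,m}}}$ $(m\ge 1)$ be the normalized eigenfunctions. All these objects are well defined: the Neumann eigenvalues form an infinite strictly increasing sequence which the $\lambda_{N,m}$ enumerate completely, the Dirichlet eigenvalues likewise, and $f_{N,m}$, $f_{D,m}$ are eigenfunctions for $\lambda_{N,m}$, $\lambda_{D,m}$. Moreover, for every $m\ge 0$ there is a constant $c(m)>0$, depending only on $m$ and $\mu$, with the following property. Let $(\mu_n)_n$ be any sequence of non-atomic Borel probability measures on $[0,1]$ whose distribution functions $F_n$ converge to $F$ uniformly on $[0,1]$, and let $f_{N,m,n}$ and $f_{D,m,n}$ be the normalized eigenfunctions defined as above with $\mu_n$ in place of $\mu$. Then $f_{N,m,n}\to f_{N,m}$ uniformly on $[0,1]$ as $n\to\infty$, and there is $n_0(m)$ (which may depend on the sequence) such that $$\lVert f_{N,m}-f_{N,m,n}\rVert_\infty\le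 c(m)\,\lVert F-F_n\rVert_\infty\qquad\text{for all } n\ge n_0(m),$$ where $\lVert\cdot\rVert_\infty$ is the supremum norm on $[0,1]$. The same holds for every $m\ge 1$ with $f_{D,m}$, $f_{D,m,n}$ in place of $f_{N,m}$, $f_{N,m,n}$. -/

import Mathlib

open MeasureTheory Set Filter
open scoped ENNReal NNReal

noncomputable section

namespace KreinFeller

/-- A non-atomic Borel probability measure on `[0,1]`, seen as a measure on `ℝ` that gives
`[0,1]` full mass. -/
structure IsNonatomicProb (μ : Measure ℝ) : Prop where
  prob : IsProbabilityMeasure μ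
  noAtoms : ∀ x, μ {x} = 0
  concentrated : μ (Icc (0 : ℝ) 1)ᶜ = 0

/-- The classical derivative of `f` on `[0,1]` (one-sided at the end points). -/
def deriv01 (f : ℝ → ℝ) (x : ℝ) : ℝ := derivWithin f (Icc (0 : ℝ) 1) x

/-- `f` lies in the domain of the Krein-Feller operator `d/dμ d/dx` and `g` is (a version of)
its image `(f')^μ`: `f ∈ C¹([0,1])`, `g ∈ L₂([0,1], μ)` and
`f'(x) = f'(0) + ∫₀ˣ g dμ` for all `x ∈ [0,1]`. -/
def HasKreinFeller (μ : Measure ℝ) (f g : ℝ → ℝ) : Prop :=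
  ContDiffOn ℝ 1 f (Icc (0 : ℝ) 1) ∧ MemLp g 2 μ ∧
    ∀ x ∈ Icc (0 : ℝ) 1, deriv01 f x = deriv01 f 0 + ∫ y in (0 : ℝ)..x, g y ∂μ

/-- `f` is a nontrivial solution of `d/dμ d/dx f = - lam * f` (equality in `L₂([0,1], μ)`). -/
def SolvesEigen (μ : Measure ℝ) (lam : ℝ) (f : ℝ → ℝ) : Prop :=
  (∃ g, HasKreinFeller μ f g ∧ g =ᵐ[μ] fun x => -lam * f x) ∧ ∃ x ∈ Icc (0 : ℝ) 1, f x ≠ 0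

/-- Eigenfunctions under Neumann boundary conditions `f'(0) = f'(1) = 0`. -/
def IsNeumannEigenfunction (μ : Measure ℝ) (lam : ℝ) (f : ℝ → ℝ) : Prop :=
  SolvesEigen μ lam f ∧ deriv01 f 0 = 0 ∧ deriv01 f 1 = 0

/-- Eigenfunctions under Dirichlet boundary conditions `f(0) = f(1) = 0`. -/
def IsDirichletEigenfunction (μ : Measure ℝ) (lam : ℝ) (f : ℝ → ℝ) : Prop :=
  SolvesEigen μ lam f ∧ f 0 = 0 ∧ f 1 = 0

/-- The set of Neumann eigenvalues. -/
def neumannSpectrum (μ : Measure ℝ) : Set ℝ := {lam | ∃ f, IsNeumannEigenfunction μ lam f}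

/-- The set of Dirichlet eigenvalues. -/
def dirichletSpectrum (μ : Measure ℝ) : Set ℝ := {lam | ∃ f, IsDirichletEigenfunction μ lam f}

/-- The elements of a set of reals in increasing order, counted from `0`: first the smallest
element, then each time the smallest element above the previous one. -/
def nthSmallest (S : Set ℝ) : ℕ → ℝ
  | 0 => sInf S
  | m + 1 => sInf (S ∩ Ioi (nthSmallest S m))

/-- The Neumann eigenvalue `λ_{N,m}`, `m = 0, 1, 2, …`. -/
def neumannEigenvalue (μ : Measure ℝ) (m : ℕ) : ℝ := nthSmallest (neumannSpectrum μ) m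

/-- The Dirichlet eigenvalue `λ_{D,m}`, `m = 1, 2, …` (only used for `1 ≤ m`). -/
def dirichletEigenvalue (μ : Measure ℝ) (m : ℕ) : ℝ := nthSmallest (dirichletSpectrum μ) (m - 1)

/-- `p₀ = 1`, `pₙ(x) = ∫₀ˣ pₙ₋₁ dμ` for odd `n` and `pₙ(x) = ∫₀ˣ pₙ₋₁(t) dt` for even `n ≥ 2`. -/
def p (μ : Measure ℝ) : ℕ → ℝ → ℝ
  | 0 => fun _ => 1
  | n + 1 => fun x =>
      if Odd (n + 1) then ∫ t in (0 : ℝ)..x, p μ n t ∂μ else ∫ t in (0 : ℝ)..x, p μ n t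

/-- `q₀ = 1`, `qₙ(x) = ∫₀ˣ qₙ₋₁(t) dt` for odd `n` and `qₙ(x) = ∫₀ˣ qₙ₋₁ dμ` for even `n ≥ 2`. -/
def q (μ : Measure ℝ) : ℕ → ℝ → ℝ
  | 0 => fun _ => 1
  | n + 1 => fun x =>
      if Odd (n + 1) then ∫ t in (0 : ℝ)..x, q μ n t else ∫ t in (0 : ℝ)..x, q μ n t ∂μ

/-- The measure theoretic cosine `cp_z`. -/
def cp (μ : Measure ℝ) (z x : ℝ) : ℝ := ∑' n : ℕ, (-1) ^ n * z ^ (2 * n) * p μ (2 * n) x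

/-- The measure theoretic sine `sq_z`. -/
def sq (μ : Measure ℝ) (z x : ℝ) : ℝ := ∑' n : ℕ, (-1) ^ n * z ^ (2 * n + 1) * q μ (2 * n + 1) x

/-- The normalized Neumann eigenfunction `f_{N,m} = cp_z` with `z = √λ_{N,m}`. -/
def neumannEigenfunction (μ : Measure ℝ) (m : ℕ) : ℝ → ℝ := cp μ √(neumannEigenvalue μ m)

/-- The normalized Dirichlet eigenfunction `f_{D,m} = sq_z` with `z = √λ_{D,m}`. -/
def dirichletEigenfunction (μ : Measure ℝ) (m : ℕ) : ℝ → ℝ := sq μ √(dirichletEigenvalue μ m)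

/-- The distribution function `F(x) = μ [0,x]`. -/
def distFun (μ : Measure ℝ) (x : ℝ) : ℝ := μ.real (Icc 0 x)

/-- `‖f - g‖_∞`, the supremum norm being that of `[0,1]`, as an extended nonnegative number. -/
def supDist (f g : ℝ → ℝ) : ℝ≥0∞ := ⨆ x ∈ Icc (0 : ℝ) 1, ENNReal.ofReal |f x - g x|

end KreinFeller

end

/-! The argument is a shooting method whose quantitative steps rest on integration by parts and the
Lagrange identity. For initial data (a, b), the Neumann series of the Volterra operator f ↦ ∫₀ˣ∫₀ᵗ f
dμ dt yields the unique solution `fund μ a b l`. On [0,1], `cp` and `sq` at √l are multiples of it,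
and the Neumann and Dirichlet spectra are the zero sets in l of u'(1) for data (1, 0) and of u(1)
for data (0, 1).

Stability of solutions: integration by parts trades a change of measure for a change of distribution
function, and a Gronwall inequality then makes u and u' Lipschitz in l and F (`IsSol.abs_sub_le`).

Stability of zeros: write χ for the characteristic function, A for the complementary boundary value
(up to sign) and J(l, k) = ∫ u_l u_k dμ. At a zero a of χ the Lagrange identity reads A(a) χ(k) = (k
- a) J(a, k). Since J is continuous and positive on the diagonal, zeros are isolated, persist under
perturbation without splitting, and move by at most a constant times the perturbation. An induction
on the index (`CharData.nthSmallest_close`) matches the i-th zeros. Combined with the stability of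
solutions this gives the estimate for eigenfunctions.

Infinitely many eigenvalues: the mixed problem u(0) = u'(1) = 0 has Green kernel min(x, y) = ∫₀¹
1_{x>t} 1_{y>t} dt on [0,1], so its Green operator is the average of the rank-one operators of the
tail indicators in L₂(μ). It is compact and symmetric; finitely many eigenvalues would confine all
tail indicators to a finite-dimensional space, which is impossible without atoms. Interlacing then
transfers infinitude to the Dirichlet and Neumann problems. -/

namespace KreinFeller

/-! ### Integration by parts, comparison of measures, Gronwall. -/

open Topology intervalIntegral

/-- Integration by parts against a finite measure: `∫ u h dμ = u H - ∫ u' H dt`, where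
`H` is the primitive of `h`. -/
theorem integral_mul_eq_sub_primitive {μ : Measure ℝ} [IsFiniteMeasure μ] {u v h : ℝ → ℝ}
    (hu : ∀ x, HasDerivAt u (v x) x) (hv : Continuous v) (hh : Integrable h μ) {x : ℝ}
    (hx : 0 ≤ x) :
    ∫ y in (0 : ℝ)..x, u y * h y ∂μ =
      u x * (∫ y in (0 : ℝ)..x, h y ∂μ) - ∫ t in (0 : ℝ)..x, v t * ∫ y in (0 : ℝ)..t, h y ∂μ := by
  have huc : Continuous u := continuous_iff_continuousAt.2 fun x => (hu x).continuousAt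
  -- Fubini for v(t) h(y) on the triangle y ≤ t: integrating in y first produces the primitive of h,
  -- integrating in t first produces u(x) - u(y).
  set F : ℝ → ℝ → ℝ := fun t y => ({z : ℝ × ℝ | z.2 ≤ z.1}.indicator
    (fun z => v z.1 * h z.2)) (t, y) with hF
  have hint : Integrable (Function.uncurry F)
      ((volume.restrict (Ioc 0 x)).prod (μ.restrict (Ioc 0 x))) := by
    have h1 : Integrable v (volume.restrict (Ioc 0 x)) :=
      (hv.integrableOn_Icc (a := 0) (b := x)).mono_set Ioc_subset_Icc_self
    have h2 : Integrable h (μ.restrict (Ioc 0 x)) := hh.mono_measure Measure.restrict_le_self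
    have := (h1.mul_prod h2).indicator (s := {z : ℝ × ℝ | z.2 ≤ z.1})
      (measurableSet_le measurable_snd measurable_fst)
    exact this
  have key := integral_integral_swap hint
  have lhs : ∫ t in Ioc 0 x, ∫ y in Ioc 0 x, F t y ∂μ =
      ∫ t in (0 : ℝ)..x, v t * ∫ y in (0 : ℝ)..t, h y ∂μ := by
    rw [integral_of_le hx]
    refine setIntegral_congr_fun measurableSet_Ioc fun t ht => ?_
    have : ∀ y, F t y = (Iic t).indicator (fun y => v t * h y) y := by
      intro y; simp only [hF, indicator, mem_ofPred_eq, mem_Iic]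
    simp only [this]
    rw [setIntegral_indicator measurableSet_Iic, integral_of_le ht.1.le, ← MeasureTheory.integral_const_mul,
      Ioc_inter_Iic, min_eq_right ht.2]
  have rhs : ∫ y in Ioc 0 x, (∫ t in Ioc 0 x, F t y) ∂μ =
      ∫ y in Ioc 0 x, (u x - u y) * h y ∂μ := by
    refine setIntegral_congr_fun measurableSet_Ioc fun y hy => ?_
    have : ∀ t, F t y = (Ici y).indicator (fun t => v t * h y) t := by
      intro t; simp only [hF, indicator, mem_ofPred_eq, mem_Ici]
    simp only [this]
    rw [setIntegral_indicator measurableSet_Ici, MeasureTheory.integral_mul_const]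
    have : Ioc 0 x ∩ Ici y = Icc y x := by
      ext t; simp only [mem_inter_iff, mem_Ioc, mem_Ici, mem_Icc]
      exact ⟨fun h => ⟨h.2, h.1.2⟩, fun h => ⟨⟨hy.1.trans_le h.1, h.2⟩, h.1⟩⟩
    rw [this, integral_Icc_eq_integral_Ioc, ← integral_of_le hy.2,
      integral_eq_sub_of_hasDerivAt (fun t _ => hu t) (hv.intervalIntegrable _ _)]
  rw [lhs, rhs] at key
  rw [key, integral_of_le hx, integral_of_le hx, ← MeasureTheory.integral_const_mul,
    ← MeasureTheory.integral_sub]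
  · refine setIntegral_congr_fun measurableSet_Ioc fun y _ => ?_
    ring
  · exact (hh.mono_measure Measure.restrict_le_self).const_mul _
  · have h2 : IntegrableOn h (Icc 0 x) μ := hh.mono_measure Measure.restrict_le_self
    have := h2.continuousOn_mul (g := fun y => u x - u y) (by fun_prop) isCompact_Icc
    exact this.mono_set Ioc_subset_Icc_self

section Prob

variable {μ : Measure ℝ}

theorem IsNonatomicProb.nullSingletonClass (h : IsNonatomicProb μ) : NullSingletonClass μ :=
  ⟨h.noAtoms⟩

theorem IsNonatomicProb.ae_mem (h : IsNonatomicProb μ) : ∀ᵐ x ∂μ, x ∈ Icc (0 : ℝ) 1 := by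
  rw [ae_iff]; exact h.concentrated

theorem IsNonatomicProb.integrable (h : IsNonatomicProb μ) {f : ℝ → ℝ} (hf : Continuous f) :
    Integrable f μ := by
  have := h.prob
  obtain ⟨C, hC⟩ := isCompact_Icc.exists_bound_of_continuousOn (hf.continuousOn (s := Icc 0 1))
  exact Integrable.of_bound hf.aestronglyMeasurable C (h.ae_mem.mono fun x hx => hC x hx)

theorem IsNonatomicProb.integral_eq (h : IsNonatomicProb μ) (f : ℝ → ℝ) :
    ∫ x, f x ∂μ = ∫ x in (0 : ℝ)..1, f x ∂μ := by
  have := h.nullSingletonClass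
  rw [integral_of_le zero_le_one, ← integral_Icc_eq_integral_Ioc,
    Measure.restrict_eq_self_of_ae_mem h.ae_mem]

theorem IsNonatomicProb.continuous_primitive (h : IsNonatomicProb μ) {f : ℝ → ℝ}
    (hf : Continuous f) : Continuous fun x => ∫ t in (0 : ℝ)..x, f t ∂μ := by
  have := h.nullSingletonClass
  exact (h.integrable hf).continuous_primitive 0

theorem IsNonatomicProb.integral_one (h : IsNonatomicProb μ) {x : ℝ} (hx : 0 ≤ x) :
    ∫ _t in (0 : ℝ)..x, (1 : ℝ) ∂μ = distFun μ x := by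
  have := h.nullSingletonClass
  have := h.prob
  rw [integral_of_le hx, ← integral_Icc_eq_integral_Ioc, distFun]
  simp

/-- An integral over `[0,x]` against a probability measure is bounded by the supremum. -/
theorem IsNonatomicProb.abs_integral_le (h : IsNonatomicProb μ) {f : ℝ → ℝ} {x C : ℝ}
    (hx : 0 ≤ x) (hC : ∀ t ∈ Icc 0 x, |f t| ≤ C) : |∫ t in (0 : ℝ)..x, f t ∂μ| ≤ C := by
  have := h.prob
  have hC0 : 0 ≤ C := (abs_nonneg _).trans (hC 0 ⟨le_rfl, hx⟩)
  rw [integral_of_le hx]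
  have := norm_setIntegral_le_of_norm_le_const (μ := μ) (s := Ioc 0 x) (f := f) (C := C)
    (measure_lt_top _ _) (fun t ht => hC t ⟨ht.1.le, ht.2⟩)
  refine this.trans (mul_le_of_le_one_right hC0 measureReal_le_one)

/-- Comparison of the integrals of a `C¹` function against two measures. -/
theorem abs_integral_sub_integral_le {μ' : Measure ℝ} (h : IsNonatomicProb μ)
    (h' : IsNonatomicProb μ') {w w' : ℝ → ℝ} (hw : ∀ x, HasDerivAt w (w' x) x)
    (hw' : Continuous w') {M δ : ℝ} (hM : ∀ x ∈ Icc (0 : ℝ) 1, |w x| ≤ M)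
    (hM' : ∀ x ∈ Icc (0 : ℝ) 1, |w' x| ≤ M)
    (hδ : ∀ x ∈ Icc (0 : ℝ) 1, |distFun μ' x - distFun μ x| ≤ δ) {x : ℝ} (hx : x ∈ Icc (0 : ℝ) 1) :
    |(∫ t in (0 : ℝ)..x, w t ∂μ') - ∫ t in (0 : ℝ)..x, w t ∂μ| ≤ 2 * M * δ := by
  have := h.prob
  have := h'.prob
  have hM0 : 0 ≤ M := (abs_nonneg _).trans (hM x hx)
  have hδ0 : 0 ≤ δ := (abs_nonneg _).trans (hδ x hx)
  -- Parts with h = 1 leaves only the difference of the distribution functions. The boundary term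
  -- and the integral term each cost M δ.
  have e := integral_mul_eq_sub_primitive (μ := μ) hw hw' (integrable_const (1 : ℝ)) hx.1
  have e' := integral_mul_eq_sub_primitive (μ := μ') hw hw' (integrable_const (1 : ℝ)) hx.1
  simp only [mul_one] at e e'
  have c := h.continuous_primitive (continuous_const (y := (1 : ℝ)))
  have c' := h'.continuous_primitive (continuous_const (y := (1 : ℝ)))
  have hd : ∀ t ∈ Icc (0 : ℝ) 1,
      |(∫ _y in (0 : ℝ)..t, (1 : ℝ) ∂μ') - ∫ _y in (0 : ℝ)..t, (1 : ℝ) ∂μ| ≤ δ := by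
    intro t ht
    rw [h.integral_one ht.1, h'.integral_one ht.1]; exact hδ t ht
  have e2 : (∫ t in (0 : ℝ)..x, w t ∂μ') - ∫ t in (0 : ℝ)..x, w t ∂μ =
      w x * ((∫ _y in (0 : ℝ)..x, (1 : ℝ) ∂μ') - ∫ _y in (0 : ℝ)..x, (1 : ℝ) ∂μ) -
      ∫ t in (0 : ℝ)..x, w' t *
        ((∫ _y in (0 : ℝ)..t, (1 : ℝ) ∂μ') - ∫ _y in (0 : ℝ)..t, (1 : ℝ) ∂μ) := by
    rw [e, e']
    simp only [mul_sub]
    rw [intervalIntegral.integral_sub (Continuous.intervalIntegrable (by fun_prop) _ _)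
      (Continuous.intervalIntegrable (by fun_prop) _ _)]
    ring
  rw [e2]
  have b1 : |w x * ((∫ _y in (0 : ℝ)..x, (1 : ℝ) ∂μ') - ∫ _y in (0 : ℝ)..x, (1 : ℝ) ∂μ)| ≤
      M * δ := by
    rw [abs_mul]; exact mul_le_mul (hM x hx) (hd x hx) (abs_nonneg _) hM0
  have b2 : |∫ t in (0 : ℝ)..x, w' t *
        ((∫ _y in (0 : ℝ)..t, (1 : ℝ) ∂μ') - ∫ _y in (0 : ℝ)..t, (1 : ℝ) ∂μ)| ≤ M * δ := by
    have := norm_integral_le_of_norm_le_const (a := 0) (b := x) (C := M * δ) (f := fun t => w' t *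
        ((∫ _y in (0 : ℝ)..t, (1 : ℝ) ∂μ') - ∫ _y in (0 : ℝ)..t, (1 : ℝ) ∂μ)) (by
      intro t ht
      rw [uIoc_of_le hx.1] at ht
      have ht' : t ∈ Icc (0 : ℝ) 1 := ⟨ht.1.le, ht.2.trans hx.2⟩
      rw [Real.norm_eq_abs, abs_mul]
      exact mul_le_mul (hM' t ht') (hd t ht') (abs_nonneg _) hM0)
    rw [sub_zero, abs_of_nonneg hx.1] at this
    exact this.trans (mul_le_of_le_one_right (by positivity) hx.2)
  have := abs_sub (w x * ((∫ _y in (0 : ℝ)..x, (1 : ℝ) ∂μ') - ∫ _y in (0 : ℝ)..x, (1 : ℝ) ∂μ))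
    (∫ t in (0 : ℝ)..x, w' t *
        ((∫ _y in (0 : ℝ)..t, (1 : ℝ) ∂μ') - ∫ _y in (0 : ℝ)..t, (1 : ℝ) ∂μ))
  linarith

/-- A Gronwall inequality for the Volterra operator of the Krein-Feller equation. -/
theorem IsNonatomicProb.gronwall (h : IsNonatomicProb μ) {w : ℝ → ℝ} (hw : Continuous w)
    {ε L : ℝ} (hL : 0 < L)
    (hle : ∀ x ∈ Icc (0 : ℝ) 1,
      |w x| ≤ ε + L * |∫ t in (0 : ℝ)..x, ∫ y in (0 : ℝ)..t, w y ∂μ|) :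
    ∀ x ∈ Icc (0 : ℝ) 1, |w x| ≤ 2 * ε * Real.exp (2 * L) := by
  -- The exponential weight makes the Volterra operator a contraction: the μ-integral costs a factor
  -- at most 1, and integrating exp(2Lt) gains 1/(2L), so the term with L is absorbed at the maximum
  -- point of the weighted function.
  obtain ⟨x₀, hx₀, hmax⟩ := isCompact_Icc.exists_isMaxOn (nonempty_Icc.2 (zero_le_one' ℝ))
    (f := fun x => |w x| * Real.exp (-(2 * L * x))) (by fun_prop)
  set S := |w x₀| * Real.exp (-(2 * L * x₀)) with hS
  have hS0 : 0 ≤ S := by positivity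
  have hwS : ∀ x ∈ Icc (0 : ℝ) 1, |w x| ≤ S * Real.exp (2 * L * x) := by
    intro x hx
    have : |w x| * Real.exp (-(2 * L * x)) ≤ S := hmax hx
    rwa [Real.exp_neg, ← div_eq_mul_inv, div_le_iff₀ (Real.exp_pos _)] at this
  have hint : ∀ x ∈ Icc (0 : ℝ) 1, |∫ t in (0 : ℝ)..x, ∫ y in (0 : ℝ)..t, w y ∂μ| ≤
      S * ((Real.exp (2 * L * x) - 1) / (2 * L)) := by
    intro x hx
    have h1 : |∫ t in (0 : ℝ)..x, ∫ y in (0 : ℝ)..t, w y ∂μ| ≤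
        ∫ t in (0 : ℝ)..x, S * Real.exp (2 * L * t) := by
      have := norm_integral_le_of_norm_le (μ := volume) (a := 0) (b := x)
        (f := fun t => ∫ y in (0 : ℝ)..t, w y ∂μ) (g := fun t => S * Real.exp (2 * L * t)) hx.1
        (Eventually.of_forall fun t ht => by
          refine h.abs_integral_le ht.1.le fun y hy => ?_
          refine (hwS y ⟨hy.1, hy.2.trans (ht.2.trans hx.2)⟩).trans ?_
          have := hy.2
          gcongr) (by apply Continuous.intervalIntegrable; fun_prop)
      exact this
    rw [intervalIntegral.integral_const_mul] at h1
    have h2 : ∫ t in (0 : ℝ)..x, Real.exp (2 * L * t) = (Real.exp (2 * L * x) - 1) / (2 * L) := by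
      have hd : ∀ t ∈ uIcc 0 x, HasDerivAt (fun t => Real.exp (2 * L * t) / (2 * L))
          (Real.exp (2 * L * t)) t := by
        intro t _
        have := (((hasDerivAt_id t).const_mul (2 * L)).exp).div_const (2 * L)
        simp only [id, mul_one] at this
        rwa [mul_div_assoc, div_self (by positivity), mul_one] at this
      rw [integral_eq_sub_of_hasDerivAt hd (by apply Continuous.intervalIntegrable; fun_prop)]
      simp [sub_div]
    rwa [h2] at h1
  have hSε : S ≤ 2 * ε := by
    have h1 := (hle x₀ hx₀).trans (add_le_add_right (mul_le_mul_of_nonneg_left (hint x₀ hx₀) hL.le) ε)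
    have h2 : L * (S * ((Real.exp (2 * L * x₀) - 1) / (2 * L))) =
        S / 2 * (Real.exp (2 * L * x₀) - 1) := by field_simp
    have h3 : |w x₀| = S * Real.exp (2 * L * x₀) := by
      rw [hS, mul_assoc, ← Real.exp_add]; simp
    rw [h2, h3] at h1
    have h4 : 1 ≤ Real.exp (2 * L * x₀) := Real.one_le_exp (by have := hx₀.1; positivity)
    -- Nonnegativity of ε is not assumed; it is forced by S ≥ 0.
    have hε : 0 ≤ ε := by
      by_contra! hneg
      nlinarith
    nlinarith
  intro x hx
  refine (hwS x hx).trans ?_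
  have : Real.exp (2 * L * x) ≤ Real.exp (2 * L) :=
    Real.exp_le_exp.2 (mul_le_of_le_one_right (by positivity) hx.2)
  exact mul_le_mul hSε this (Real.exp_pos _).le (hS0.trans hSε)

end Prob

end KreinFeller

/-! ### A priori bounds, Lipschitz dependence and bilinear identities for solutions. -/

namespace KreinFeller

open Topology intervalIntegral

/-- `u` with derivative `v` solves `d/dμ d/dx u = -l u` on `[0,1]`. -/
structure IsSol (μ : Measure ℝ) (l : ℝ) (u v : ℝ → ℝ) : Prop where
  hasDerivAt : ∀ x, HasDerivAt u (v x) x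
  continuous_deriv : Continuous v
  deriv_eq : ∀ x ∈ Icc (0 : ℝ) 1, v x = v 0 - l * ∫ t in (0 : ℝ)..x, u t ∂μ

/-- A constant bounding the growth of solutions for spectral parameters `|l| ≤ L`. -/
noncomputable def solBound (L : ℝ) : ℝ := 2 * (1 + L) * Real.exp (2 * L)

theorem solBound_pos {L : ℝ} (hL : 0 < L) : 0 < solBound L := by
  unfold solBound; positivity

namespace IsSol

variable {μ μ' : Measure ℝ} {l l' : ℝ} {u v u' v' : ℝ → ℝ}

theorem continuous (h : IsSol μ l u v) : Continuous u :=
  continuous_iff_continuousAt.2 fun x => (h.hasDerivAt x).continuousAt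

theorem eq_integral (h : IsSol μ l u v) (x : ℝ) : u x = u 0 + ∫ t in (0 : ℝ)..x, v t := by
  rw [integral_eq_sub_of_hasDerivAt (fun t _ => h.hasDerivAt t)
    (h.continuous_deriv.intervalIntegrable _ _)]
  ring

theorem smul (h : IsSol μ l u v) (c : ℝ) : IsSol μ l (fun x => c * u x) (fun x => c * v x) where
  hasDerivAt x := (h.hasDerivAt x).const_mul c
  continuous_deriv := h.continuous_deriv.const_mul c
  deriv_eq x hx := by
    rw [intervalIntegral.integral_const_mul, h.deriv_eq x hx]; ring

/-- Integrating the equation twice gives u = u(0) + x v(0) - l ∫∫ u, to which Gronwall applies; the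
equation itself then bounds v. The factor 1 + L in `solBound` lets one constant serve both. -/
theorem abs_le (hμ : IsNonatomicProb μ) (h : IsSol μ l u v) {L m : ℝ} (hL : 0 < L) (hl : |l| ≤ L)
    (hm : |u 0| + |v 0| ≤ m) :
    ∀ x ∈ Icc (0 : ℝ) 1, |u x| ≤ solBound L * m ∧ |v x| ≤ solBound L * m := by
  have hm0 : 0 ≤ m := le_trans (by positivity) hm
  have hc := hμ.continuous_primitive h.continuous
  have hE : 1 ≤ Real.exp (2 * L) := Real.one_le_exp (by positivity)
  have hg := hμ.gronwall h.continuous (ε := m) hL (fun x hx => by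
    have e : u x = u 0 + x * v 0 - l * ∫ t in (0 : ℝ)..x, ∫ y in (0 : ℝ)..t, u y ∂μ := by
      rw [h.eq_integral x, ← intervalIntegral.integral_const_mul, add_sub_assoc]
      congr 1
      have : x * v 0 = ∫ _t in (0 : ℝ)..x, v 0 := by simp
      rw [this, ← intervalIntegral.integral_sub (Continuous.intervalIntegrable (by fun_prop) _ _)
        (Continuous.intervalIntegrable (by fun_prop) _ _)]
      refine integral_congr fun t ht => ?_
      rw [uIcc_of_le hx.1] at ht
      exact h.deriv_eq t ⟨ht.1, ht.2.trans hx.2⟩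
    rw [e]
    refine (abs_sub _ _).trans (add_le_add ((abs_add_le _ _).trans (le_trans ?_ hm)) ?_)
    · rw [abs_mul, abs_of_nonneg hx.1]
      gcongr
      exact mul_le_of_le_one_left (abs_nonneg _) hx.2
    · rw [abs_mul]; gcongr)
  have hu : ∀ x ∈ Icc (0 : ℝ) 1, |u x| ≤ 2 * m * Real.exp (2 * L) := hg
  intro x hx
  refine ⟨(hu x hx).trans ?_, ?_⟩
  · unfold solBound
    nlinarith [mul_nonneg hL.le (mul_nonneg hm0 (zero_le_one.trans hE))]
  · rw [h.deriv_eq x hx]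
    have h1 : |∫ t in (0 : ℝ)..x, u t ∂μ| ≤ 2 * m * Real.exp (2 * L) :=
      hμ.abs_integral_le hx.1 fun t ht => hu t ⟨ht.1, ht.2.trans hx.2⟩
    have h2 : |l * ∫ t in (0 : ℝ)..x, u t ∂μ| ≤ L * (2 * m * Real.exp (2 * L)) := by
      rw [abs_mul]; gcongr
    have h3 := abs_sub (v 0) (l * ∫ t in (0 : ℝ)..x, u t ∂μ)
    have h4 : |v 0| ≤ m := by linarith [abs_nonneg (u 0)]
    unfold solBound
    nlinarith

/-- Solutions depend in a Lipschitz way on the spectral parameter and on the distribution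
function of the measure. -/
theorem abs_sub_le (hμ : IsNonatomicProb μ) (hμ' : IsNonatomicProb μ') (h : IsSol μ l u v)
    (h' : IsSol μ' l' u' v') (hu0 : u' 0 = u 0) (hv0 : v' 0 = v 0) {L m δ : ℝ} (hL : 0 < L)
    (hl : |l| ≤ L) (hl' : |l'| ≤ L) (hm : |u 0| + |v 0| ≤ m)
    (hδ : ∀ x ∈ Icc (0 : ℝ) 1, |distFun μ' x - distFun μ x| ≤ δ) :
    ∀ x ∈ Icc (0 : ℝ) 1,
      |u' x - u x| ≤ solBound L ^ 2 * (1 + 2 * L) * m * (|l' - l| + δ) ∧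
      |v' x - v x| ≤ solBound L ^ 2 * (1 + 2 * L) * m * (|l' - l| + δ) := by
  have hm0 : 0 ≤ m := le_trans (by positivity) hm
  have hδ0 : 0 ≤ δ := (abs_nonneg _).trans (hδ 0 (by simp))
  have hb := h.abs_le hμ hL hl hm
  set M := solBound L * m with hM
  have hM0 : 0 ≤ M := (abs_nonneg _).trans (hb 0 (by simp)).1
  set ε := M * (1 + 2 * L) * (|l' - l| + δ) with hε
  have hε0 : 0 ≤ ε := by positivity
  -- The residual: `R` rewrites as -(l' - l) ∫ u dμ' - l (∫ u dμ' - ∫ u dμ), which contains only the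
  -- fixed solution u. Hence it is of the size of the data, and u' - u satisfies a Volterra
  -- inequality with `R` as forcing.
  set R : ℝ → ℝ := fun t => v' t - v t + l' * ∫ y in (0 : ℝ)..t, (u' y - u y) ∂μ' with hR
  have hcw : Continuous fun x => u' x - u x := h'.continuous.sub h.continuous
  have hcp := hμ'.continuous_primitive hcw
  have hv := h.continuous_deriv
  have hv' := h'.continuous_deriv
  have hRb : ∀ t ∈ Icc (0 : ℝ) 1, |R t| ≤ ε := by
    intro t ht
    have e : R t = -((l' - l) * ∫ y in (0 : ℝ)..t, u y ∂μ') -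
        l * ((∫ y in (0 : ℝ)..t, u y ∂μ') - ∫ y in (0 : ℝ)..t, u y ∂μ) := by
      simp only [hR]
      rw [h.deriv_eq t ht, h'.deriv_eq t ht, hv0, intervalIntegral.integral_sub
        (hμ'.integrable h'.continuous).intervalIntegrable
        (hμ'.integrable h.continuous).intervalIntegrable]
      ring
    have b1 : |∫ y in (0 : ℝ)..t, u y ∂μ'| ≤ M :=
      hμ'.abs_integral_le ht.1 fun y hy => (hb y ⟨hy.1, hy.2.trans ht.2⟩).1
    have b2 := abs_integral_sub_integral_le hμ hμ' h.hasDerivAt h.continuous_deriv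
      (fun x hx => (hb x hx).1) (fun x hx => (hb x hx).2) hδ ht
    rw [e]
    refine (abs_sub _ _).trans ?_
    rw [abs_neg, abs_mul, abs_mul]
    have c1 : |l' - l| * |∫ y in (0 : ℝ)..t, u y ∂μ'| ≤ |l' - l| * M := by gcongr
    have c2 : |l| * |(∫ y in (0 : ℝ)..t, u y ∂μ') - ∫ y in (0 : ℝ)..t, u y ∂μ| ≤
      L * (2 * M * δ) := by gcongr
    have : 0 ≤ M * L * |l' - l| := by positivity
    have : 0 ≤ M * δ := by positivity
    rw [hε]
    nlinarith
  have hw := hμ'.gronwall hcw (ε := ε) hL (fun x hx => by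
    have e : u' x - u x = (∫ t in (0 : ℝ)..x, R t) -
        l' * ∫ t in (0 : ℝ)..x, ∫ y in (0 : ℝ)..t, (u' y - u y) ∂μ' := by
      rw [← intervalIntegral.integral_const_mul, ← intervalIntegral.integral_sub
        (Continuous.intervalIntegrable (by fun_prop) _ _)
        (Continuous.intervalIntegrable (by fun_prop) _ _), h'.eq_integral x, h.eq_integral x, hu0,
        add_sub_add_left_eq_sub, ← intervalIntegral.integral_sub
        (hv'.intervalIntegrable _ _) (hv.intervalIntegrable _ _)]
      refine integral_congr fun t _ => ?_
      simp only [hR]; ring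
    rw [e]
    refine (abs_sub _ _).trans (add_le_add ?_ ?_)
    · have := norm_integral_le_of_norm_le_const (a := 0) (b := x) (C := ε) (f := R) (fun t ht => by
        rw [uIoc_of_le hx.1] at ht
        exact hRb t ⟨ht.1.le, ht.2.trans hx.2⟩)
      rw [sub_zero, abs_of_nonneg hx.1] at this
      exact this.trans (mul_le_of_le_one_right hε0 hx.2)
    · rw [abs_mul]; gcongr)
  have hE : 1 ≤ Real.exp (2 * L) := Real.one_le_exp (by positivity)
  have hC : solBound L ^ 2 * (1 + 2 * L) * m * (|l' - l| + δ) = solBound L * ε := by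
    rw [hε, hM]; ring
  rw [hC]
  have hs : solBound L = 2 * Real.exp (2 * L) + L * (2 * Real.exp (2 * L)) := by
    unfold solBound; ring
  intro x hx
  have hpos : 0 ≤ L * (2 * Real.exp (2 * L)) * ε := by positivity
  refine ⟨(hw x hx).trans (by rw [hs]; linarith), ?_⟩
  have e : v' x - v x = R x - l' * ∫ y in (0 : ℝ)..x, (u' y - u y) ∂μ' := by
    simp only [hR]; ring
  have b : |∫ y in (0 : ℝ)..x, (u' y - u y) ∂μ'| ≤ 2 * ε * Real.exp (2 * L) :=
    hμ'.abs_integral_le hx.1 fun t ht => hw t ⟨ht.1, ht.2.trans hx.2⟩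
  have b' : |l' * ∫ y in (0 : ℝ)..x, (u' y - u y) ∂μ'| ≤ L * (2 * ε * Real.exp (2 * L)) := by
    rw [abs_mul]; gcongr
  have := abs_sub (R x) (l' * ∫ y in (0 : ℝ)..x, (u' y - u y) ∂μ')
  have := hRb x hx
  rw [e, hs]
  nlinarith

/-- Uniqueness is the Lipschitz estimate with equal measures, equal parameters and δ = 0. -/
theorem eq_of_initial (hμ : IsNonatomicProb μ) (h : IsSol μ l u v) (h' : IsSol μ l u' v')
    (hu0 : u' 0 = u 0) (hv0 : v' 0 = v 0) : ∀ x ∈ Icc (0 : ℝ) 1, u' x = u x ∧ v' x = v x := by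
  intro x hx
  have := abs_sub_le hμ hμ h h' hu0 hv0 (L := |l| + 1) (δ := 0) (by positivity) (by linarith)
    (by linarith) le_rfl (by simp) x hx
  simp only [sub_self, abs_zero, add_zero, mul_zero, abs_nonpos_iff, sub_eq_zero] at this
  exact this

/-- Green's identity. -/
theorem green (hμ : IsNonatomicProb μ) (h : IsSol μ l u v) {w w' : ℝ → ℝ}
    (hw : ∀ x, HasDerivAt w (w' x) x) (hw' : Continuous w') :
    l * ∫ x, w x * u x ∂μ = w 0 * v 0 - w 1 * v 1 + ∫ t in (0 : ℝ)..1, w' t * v t := by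
  have := hμ.prob
  rw [hμ.integral_eq, integral_mul_eq_sub_primitive hw hw' (hμ.integrable h.continuous)
    zero_le_one]
  have e1 : ∫ t in (0 : ℝ)..1, l * (w' t * ∫ y in (0 : ℝ)..t, u y ∂μ) =
      ∫ t in (0 : ℝ)..1, (w' t * v 0 - w' t * v t) := by
    refine integral_congr fun t ht => ?_
    rw [uIcc_of_le zero_le_one] at ht
    simp only [h.deriv_eq t ht]; ring
  have hv := h.continuous_deriv
  rw [intervalIntegral.integral_const_mul] at e1
  rw [mul_sub, e1, intervalIntegral.integral_sub (Continuous.intervalIntegrable (by fun_prop) _ _)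
    (Continuous.intervalIntegrable (by fun_prop) _ _), intervalIntegral.integral_mul_const,
    integral_eq_sub_of_hasDerivAt (fun t _ => hw t) (hw'.intervalIntegrable _ _),
    h.deriv_eq 1 (by simp)]
  ring

/-- The Lagrange identity. -/
theorem lagrange (hμ : IsNonatomicProb μ) (h : IsSol μ l u v) (h' : IsSol μ l' u' v') :
    (v 1 * u' 1 - u 1 * v' 1) - (v 0 * u' 0 - u 0 * v' 0) = (l' - l) * ∫ x, u x * u' x ∂μ := by
  have g1 := h'.green hμ h.hasDerivAt h.continuous_deriv
  have g2 := h.green hμ h'.hasDerivAt h'.continuous_deriv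
  simp only [mul_comm (u' _) (u _), mul_comm (v' _) (v _)] at g2
  rw [sub_mul, g1, g2]; ring

/-- If the integral vanished, u would be zero μ-almost everywhere, so v would be constant and u
affine on [0,1]. A nontrivial affine function has at most one zero, and a single point carries no
mass. -/
theorem integral_sq_pos (hμ : IsNonatomicProb μ) (h : IsSol μ l u v) (h0 : u 0 ≠ 0 ∨ v 0 ≠ 0) :
    0 < ∫ x, u x * u x ∂μ := by
  have := hμ.nullSingletonClass
  have := hμ.prob
  have hnn : 0 ≤ᵐ[μ] fun x => u x * u x := Eventually.of_forall fun x => mul_self_nonneg _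
  refine lt_of_le_of_ne (integral_nonneg_of_ae hnn) fun hz => ?_
  rw [eq_comm, integral_eq_zero_iff_of_nonneg_ae hnn
    (hμ.integrable (h.continuous.mul h.continuous))] at hz
  have hu : ∀ᵐ x ∂μ, u x = 0 := hz.mono fun x hx => mul_self_eq_zero.1 hx
  have hv : ∀ x ∈ Icc (0 : ℝ) 1, v x = v 0 := by
    intro x hx
    rw [h.deriv_eq x hx, integral_zero_ae (hu.mono fun x hx _ => hx)]; ring
  have hlin : ∀ x ∈ Icc (0 : ℝ) 1, u x = u 0 + x * v 0 := by
    intro x hx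
    rw [h.eq_integral x, integral_congr (g := fun _ => v 0)]
    · simp
    · intro t ht
      rw [uIcc_of_le hx.1] at ht
      exact hv t ⟨ht.1, ht.2.trans hx.2⟩
  have hall : ∀ᵐ x ∂μ, u 0 + x * v 0 = 0 := by
    filter_upwards [hu, hμ.ae_mem] with x hx hx'
    rw [← hlin x hx', hx]
  have hone : ∀ᵐ x ∂μ, x ≠ - u 0 / v 0 := by
    rw [ae_iff]; simp
  obtain ⟨x, hx, hx'⟩ := (hall.and hone).exists
  by_cases hv0 : v 0 = 0
  · simp [hv0] at hx h0
    exact h0 hx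
  · apply hx'; field_simp; linarith

/-- The `L₂` pairing of solutions is Lipschitz in the spectral parameters and the distribution
function of the measure. -/
theorem abs_integral_mul_sub_le (hμ : IsNonatomicProb μ) (hμ' : IsNonatomicProb μ')
    {l₁ l₂ l₁' l₂' : ℝ} {u₁ u₂ v₁ v₂ u₁' u₂' v₁' v₂' : ℝ → ℝ}
    (h₁ : IsSol μ l₁ u₁ v₁) (h₂ : IsSol μ l₂ u₂ v₂)
    (h₁' : IsSol μ' l₁' u₁' v₁') (h₂' : IsSol μ' l₂' u₂' v₂')
    (hu₁ : u₁' 0 = u₁ 0) (hv₁ : v₁' 0 = v₁ 0) (hu₂ : u₂' 0 = u₂ 0) (hv₂ : v₂' 0 = v₂ 0)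
    (hm₁ : |u₁ 0| + |v₁ 0| ≤ 1) (hm₂ : |u₂ 0| + |v₂ 0| ≤ 1) {L δ : ℝ} (hL : 0 < L)
    (hl₁ : |l₁| ≤ L) (hl₂ : |l₂| ≤ L) (hl₁' : |l₁'| ≤ L) (hl₂' : |l₂'| ≤ L)
    (hδ : ∀ x ∈ Icc (0 : ℝ) 1, |distFun μ' x - distFun μ x| ≤ δ) :
    |(∫ x, u₁' x * u₂' x ∂μ') - ∫ x, u₁ x * u₂ x ∂μ| ≤
      (2 * solBound L ^ 3 * (1 + 2 * L) + 4 * solBound L ^ 2) *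
        (|l₁' - l₁| + |l₂' - l₂| + δ) := by
  have hδ0 : 0 ≤ δ := (abs_nonneg _).trans (hδ 0 (by simp))
  have B₁ := h₁.abs_le hμ hL hl₁ hm₁
  have B₂ := h₂.abs_le hμ hL hl₂ hm₂
  have B₂' := h₂'.abs_le hμ' hL hl₂' (m := 1) (by rw [hu₂, hv₂]; exact hm₂)
  have D₁ := abs_sub_le hμ hμ' h₁ h₁' hu₁ hv₁ hL hl₁ hl₁' hm₁ hδ
  have D₂ := abs_sub_le hμ hμ' h₂ h₂' hu₂ hv₂ hL hl₂ hl₂' hm₂ hδ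
  have hb := (solBound_pos hL).le
  set b := solBound L
  simp only [mul_one] at B₁ B₂ B₂' D₁ D₂
  set P := b ^ 2 * (1 + 2 * L) with hP
  have hP0 : 0 ≤ P := by positivity
  have c₁ := h₁.continuous
  have c₂ := h₂.continuous
  have c₁' := h₁'.continuous
  have c₂' := h₂'.continuous
  have d₁ := h₁.continuous_deriv
  have d₂ := h₂.continuous_deriv
  -- Two changes are separated: `e1` changes the measure under the fixed product u₁u₂, whose
  -- derivative is bounded by 2b², and `e2` changes the factors under the fixed measure μ'.
  have e1 : |(∫ x in (0 : ℝ)..1, u₁ x * u₂ x ∂μ') - ∫ x in (0 : ℝ)..1, u₁ x * u₂ x ∂μ| ≤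
      2 * (2 * b ^ 2) * δ := by
    refine abs_integral_sub_integral_le hμ hμ'
      (fun x => (h₁.hasDerivAt x).mul (h₂.hasDerivAt x)) (by fun_prop) (fun x hx => ?_)
      (fun x hx => ?_) hδ (by simp)
    · rw [Pi.mul_apply, abs_mul]
      have := mul_le_mul (B₁ x hx).1 (B₂ x hx).1 (abs_nonneg _) hb
      nlinarith
    · refine (abs_add_le _ _).trans ?_
      rw [abs_mul, abs_mul]
      have := mul_le_mul (B₁ x hx).2 (B₂ x hx).1 (abs_nonneg _) hb
      have := mul_le_mul (B₁ x hx).1 (B₂ x hx).2 (abs_nonneg _) hb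
      nlinarith
  have e2 : |∫ x in (0 : ℝ)..1, (u₁' x * u₂' x - u₁ x * u₂ x) ∂μ'| ≤
      b * P * (|l₁' - l₁| + |l₂' - l₂| + 2 * δ) := by
    refine hμ'.abs_integral_le zero_le_one fun x hx => ?_
    have : u₁' x * u₂' x - u₁ x * u₂ x = (u₁' x - u₁ x) * u₂' x + u₁ x * (u₂' x - u₂ x) := by ring
    rw [this]
    refine (abs_add_le _ _).trans ?_
    rw [abs_mul, abs_mul]
    have := mul_le_mul (D₁ x hx).1 (B₂' x hx).1 (abs_nonneg _) (by positivity)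
    have := mul_le_mul (B₁ x hx).1 (D₂ x hx).1 (abs_nonneg _) hb
    nlinarith
  rw [intervalIntegral.integral_sub (hμ'.integrable (by fun_prop)).intervalIntegrable
    (hμ'.integrable (by fun_prop)).intervalIntegrable] at e2
  rw [hμ.integral_eq, hμ'.integral_eq]
  have e3 := abs_add_le ((∫ x in (0 : ℝ)..1, u₁' x * u₂' x ∂μ') -
    ∫ x in (0 : ℝ)..1, u₁ x * u₂ x ∂μ') ((∫ x in (0 : ℝ)..1, u₁ x * u₂ x ∂μ') -
    ∫ x in (0 : ℝ)..1, u₁ x * u₂ x ∂μ)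
  rw [sub_add_sub_cancel] at e3
  refine e3.trans ((add_le_add e2 e1).trans ?_)
  have h1 : 0 ≤ b * P * (|l₁' - l₁| + |l₂' - l₂|) := by positivity
  have h2 : 0 ≤ b ^ 2 * (|l₁' - l₁| + |l₂' - l₂|) := by positivity
  have : 2 * b ^ 3 * (1 + 2 * L) = 2 * (b * P) := by rw [hP]; ring
  rw [this]
  nlinarith

/-- Under self-adjoint boundary conditions eigenvalues are nonnegative. -/
theorem eigenvalue_nonneg (hμ : IsNonatomicProb μ) (h : IsSol μ l u v) (hne : u 0 ≠ 0 ∨ v 0 ≠ 0)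
    (h0 : u 0 * v 0 = 0) (h1 : u 1 * v 1 = 0) : 0 ≤ l := by
  -- Testing against u itself, the boundary terms vanish and l ∫ u² dμ = ∫ v² dt.
  have g := h.green hμ h.hasDerivAt h.continuous_deriv
  rw [h0, h1, sub_zero, zero_add] at g
  have hp := h.integral_sq_pos hμ hne
  have : 0 ≤ ∫ t in (0 : ℝ)..1, v t * v t :=
    intervalIntegral.integral_nonneg zero_le_one fun t _ => mul_self_nonneg _
  rw [← g] at this
  exact nonneg_of_mul_nonneg_left this hp

end IsSol

end KreinFeller

/-! ### Neumann series, fundamental solutions, and the functions `cp` and `sq`. -/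

namespace KreinFeller

open Topology intervalIntegral

/-- The Volterra operator `f ↦ ∫₀ˣ ∫₀ᵗ f dμ dt`. -/
noncomputable def volterra (μ : Measure ℝ) (f : ℝ → ℝ) (x : ℝ) : ℝ :=
  ∫ t in (0 : ℝ)..x, ∫ y in (0 : ℝ)..t, f y ∂μ

/-- Two steps of the recursion, one against μ and one against Lebesgue measure, make one application
of `volterra`. -/
theorem p_even (μ : Measure ℝ) (n : ℕ) : p μ (2 * n) = (volterra μ)^[n] fun _ => 1 := by
  induction n with
  | zero => rfl
  | succ n ih =>
    have h1 : p μ (2 * n + 1) = fun x => ∫ t in (0 : ℝ)..x, p μ (2 * n) t ∂μ := by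
      funext x; rw [p]; beta_reduce; rw [if_pos (by simp)]
    rw [Function.iterate_succ_apply', ← ih, show 2 * (n + 1) = 2 * n + 1 + 1 by ring]
    funext x
    rw [p]; beta_reduce; rw [if_neg (by simp [parity_simps]), h1]; rfl

theorem q_odd (μ : Measure ℝ) (n : ℕ) : q μ (2 * n + 1) = (volterra μ)^[n] fun x => x := by
  induction n with
  | zero => funext x; rw [q]; beta_reduce; rw [if_pos (by simp)]; simp [q]
  | succ n ih =>
    have h1 : q μ (2 * n + 1 + 1) = fun x => ∫ t in (0 : ℝ)..x, q μ (2 * n + 1) t ∂μ := by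
      funext x; rw [q]; beta_reduce; rw [if_neg (by simp [parity_simps])]
    rw [Function.iterate_succ_apply', ← ih, show 2 * (n + 1) + 1 = 2 * n + 1 + 1 + 1 by ring]
    funext x
    rw [q]; beta_reduce; rw [if_pos (by simp [parity_simps]), h1]; rfl

section

variable {μ : Measure ℝ}

theorem IsNonatomicProb.continuous_volterra_iterate (hμ : IsNonatomicProb μ) {f : ℝ → ℝ}
    (hf : Continuous f) (n : ℕ) : Continuous ((volterra μ)^[n] f) := by
  induction n with
  | zero => exact hf
  | succ n ih =>
    rw [Function.iterate_succ_apply']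
    exact intervalIntegral.continuous_primitive
      (fun _ _ => (hμ.continuous_primitive ih).intervalIntegrable _ _) 0

/-- The μ-integrals cost nothing, as the total mass is 1; each Lebesgue integral raises xⁿ/n! by one
degree. This gives factorial decay for every μ at once. -/
theorem IsNonatomicProb.abs_volterra_iterate_le (hμ : IsNonatomicProb μ) {f : ℝ → ℝ}
    {C : ℝ} (hC : ∀ x ∈ Icc (0 : ℝ) 1, |f x| ≤ C) (n : ℕ) :
    ∀ x ∈ Icc (0 : ℝ) 1, |(volterra μ)^[n] f x| ≤ C * (x ^ n / n.factorial) := by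
  have hC0 : 0 ≤ C := (abs_nonneg _).trans (hC 0 (by simp))
  induction n with
  | zero => simpa using hC
  | succ n ih =>
    intro x hx
    rw [Function.iterate_succ_apply']
    have h1 : |volterra μ ((volterra μ)^[n] f) x| ≤
        ∫ t in (0 : ℝ)..x, C * (t ^ n / n.factorial) := by
      refine norm_integral_le_of_norm_le (μ := volume)
        (f := fun t => ∫ y in (0 : ℝ)..t, (volterra μ)^[n] f y ∂μ)
        (g := fun t => C * (t ^ n / n.factorial)) hx.1 (Eventually.of_forall fun t ht => ?_)
        (by apply Continuous.intervalIntegrable; fun_prop)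
      refine hμ.abs_integral_le ht.1.le fun y hy => ?_
      refine (ih y ⟨hy.1, hy.2.trans (ht.2.trans hx.2)⟩).trans ?_
      have := hy.1
      have := hy.2
      gcongr
    refine h1.trans (le_of_eq ?_)
    rw [intervalIntegral.integral_const_mul, intervalIntegral.integral_div, integral_pow,
      Nat.factorial_succ]
    push_cast
    field_simp
    simp

/-- The Neumann series for the solution with initial data `(a, b)`. -/
noncomputable def fundSeries (μ : Measure ℝ) (a b l x : ℝ) : ℝ :=
  ∑' n : ℕ, (-l) ^ n * (volterra μ)^[n] (fun t => a + b * t) x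

/-- Projection of the line onto `[0,1]`. -/
noncomputable def clamp (x : ℝ) : ℝ := max 0 (min x 1)

theorem clamp_mem (x : ℝ) : clamp x ∈ Icc (0 : ℝ) 1 := by simp [clamp]

theorem clamp_eq {x : ℝ} (hx : x ∈ Icc (0 : ℝ) 1) : clamp x = x := by
  simp [clamp, hx.1, hx.2]

theorem continuous_clamp : Continuous clamp := by unfold clamp; fun_prop

theorem abs_affine_le (a b : ℝ) : ∀ x ∈ Icc (0 : ℝ) 1, |a + b * x| ≤ |a| + |b| := by
  intro x hx
  refine (abs_add_le _ _).trans ?_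
  rw [abs_mul, abs_of_nonneg hx.1]
  gcongr
  exact mul_le_of_le_one_right (abs_nonneg _) hx.2

theorem IsNonatomicProb.abs_fundSeries_term_le (hμ : IsNonatomicProb μ) (a b l : ℝ) (n : ℕ) :
    ∀ x ∈ Icc (0 : ℝ) 1, |(-l) ^ n * (volterra μ)^[n] (fun t => a + b * t) x| ≤
      (|a| + |b|) * (|l| ^ n / n.factorial) := by
  intro x hx
  rw [abs_mul, abs_pow, abs_neg]
  have h1 := hμ.abs_volterra_iterate_le (abs_affine_le a b) n x hx
  have h2 : x ^ n / (n.factorial : ℝ) ≤ 1 / n.factorial := by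
    gcongr
    exact pow_le_one₀ hx.1 hx.2
  calc |l| ^ n * |(volterra μ)^[n] (fun t => a + b * t) x|
      ≤ |l| ^ n * ((|a| + |b|) * (1 / n.factorial)) := by
        gcongr; exact h1.trans (by gcongr)
    _ = _ := by ring

theorem summable_fundSeries_bound (a b l : ℝ) :
    Summable fun n : ℕ => (|a| + |b|) * (|l| ^ n / n.factorial) :=
  (Real.summable_pow_div_factorial |l|).mul_left _

theorem IsNonatomicProb.hasSum_fundSeries (hμ : IsNonatomicProb μ) (a b l : ℝ) {x : ℝ}
    (hx : x ∈ Icc (0 : ℝ) 1) :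
    HasSum (fun n : ℕ => (-l) ^ n * (volterra μ)^[n] (fun t => a + b * t) x)
      (fundSeries μ a b l x) :=
  (Summable.of_norm_bounded (summable_fundSeries_bound a b l)
    fun n => hμ.abs_fundSeries_term_le a b l n x hx).hasSum

theorem IsNonatomicProb.continuous_fundSeries (hμ : IsNonatomicProb μ) (a b l : ℝ) :
    Continuous fun x => fundSeries μ a b l (clamp x) := by
  refine continuous_tsum (fun n => ?_) (summable_fundSeries_bound a b l)
    fun n x => hμ.abs_fundSeries_term_le a b l n _ (clamp_mem x)
  exact continuous_const.mul
    ((hμ.continuous_volterra_iterate (by fun_prop) n).comp continuous_clamp)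

/-- Applying -l times the Volterra operator shifts the series by one term. The exchange of sum and
integral is dominated convergence, done for the inner μ-integral and then for the outer one. -/
theorem IsNonatomicProb.fundSeries_eq (hμ : IsNonatomicProb μ) (a b l : ℝ) {x : ℝ}
    (hx : x ∈ Icc (0 : ℝ) 1) :
    fundSeries μ a b l x = a + b * x - l * volterra μ (fun t => fundSeries μ a b l (clamp t)) x := by
  have := hμ.prob
  set f : ℕ → ℝ → ℝ := fun n => (volterra μ)^[n] (fun t => a + b * t) with hf
  have hfc : ∀ n, Continuous (f n) := hμ.continuous_volterra_iterate (by fun_prop)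
  have hS := summable_fundSeries_bound a b l
  have inner : ∀ t ∈ Icc (0 : ℝ) 1, HasSum (fun n => ∫ y in (0 : ℝ)..t, (-l) ^ n * f n y ∂μ)
      (∫ y in (0 : ℝ)..t, fundSeries μ a b l (clamp y) ∂μ) := by
    intro t ht
    have hsub : ∀ y ∈ uIoc 0 t, y ∈ Icc (0 : ℝ) 1 := by
      intro y hy
      rw [uIoc_of_le ht.1] at hy
      exact ⟨hy.1.le, hy.2.trans ht.2⟩
    refine hasSum_integral_of_dominated_convergence
      (fun n _ => (|a| + |b|) * (|l| ^ n / n.factorial))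
      (fun n => ((hfc n).const_mul _).aestronglyMeasurable)
      (fun n => Eventually.of_forall fun y hy => hμ.abs_fundSeries_term_le a b l n y (hsub y hy))
      (Eventually.of_forall fun _ _ => hS) (by simp)
      (Eventually.of_forall fun y hy => ?_)
    rw [clamp_eq (hsub y hy)]
    exact hμ.hasSum_fundSeries a b l (hsub y hy)
  have outer : HasSum (fun n => ∫ t in (0 : ℝ)..x, ∫ y in (0 : ℝ)..t, (-l) ^ n * f n y ∂μ)
      (volterra μ (fun t => fundSeries μ a b l (clamp t)) x) := by
    have hsub : ∀ y ∈ uIoc 0 x, y ∈ Icc (0 : ℝ) 1 := by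
      intro y hy
      rw [uIoc_of_le hx.1] at hy
      exact ⟨hy.1.le, hy.2.trans hx.2⟩
    refine hasSum_integral_of_dominated_convergence
      (fun n _ => (|a| + |b|) * (|l| ^ n / n.factorial))
      (fun n => (hμ.continuous_primitive ((hfc n).const_mul _)).aestronglyMeasurable)
      (fun n => Eventually.of_forall fun t ht => ?_)
      (Eventually.of_forall fun _ _ => hS) (by simp)
      (Eventually.of_forall fun t ht => inner t (hsub t ht))
    refine hμ.abs_integral_le (hsub t ht).1 fun y hy => ?_
    exact hμ.abs_fundSeries_term_le a b l n y ⟨hy.1, hy.2.trans (hsub t ht).2⟩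
  have hs := hμ.hasSum_fundSeries a b l hx
  rw [← hasSum_nat_add_iff' 1] at hs
  have ho := outer.mul_left (-l)
  have e : (fun n : ℕ => -l * ∫ t in (0 : ℝ)..x, ∫ y in (0 : ℝ)..t, (-l) ^ n * f n y ∂μ) =
      fun n => (-l) ^ (n + 1) * (volterra μ)^[n + 1] (fun t => a + b * t) x := by
    funext n
    simp only [intervalIntegral.integral_const_mul, Function.iterate_succ_apply', hf]
    rw [volterra, pow_succ']
    ring
  rw [e] at ho
  have := hs.unique ho
  simp only [Finset.range_one, Finset.sum_singleton, pow_zero, one_mul,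
    Function.iterate_zero, id] at this
  linarith

/-- The derivative of the solution with initial data `(a, b)`. -/
noncomputable def fundDeriv (μ : Measure ℝ) (a b l x : ℝ) : ℝ :=
  b - l * ∫ t in (0 : ℝ)..clamp x, fundSeries μ a b l (clamp t) ∂μ

/-- The solution of `d/dμ d/dx u = -l u` with `u 0 = a`, `u' 0 = b`. -/
noncomputable def fund (μ : Measure ℝ) (a b l x : ℝ) : ℝ :=
  a + ∫ t in (0 : ℝ)..x, fundDeriv μ a b l t

theorem IsNonatomicProb.continuous_fundDeriv (hμ : IsNonatomicProb μ) (a b l : ℝ) :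
    Continuous (fundDeriv μ a b l) :=
  continuous_const.sub (continuous_const.mul
    ((hμ.continuous_primitive (hμ.continuous_fundSeries a b l)).comp continuous_clamp))

theorem IsNonatomicProb.fund_eq_fundSeries (hμ : IsNonatomicProb μ) (a b l : ℝ) {x : ℝ}
    (hx : x ∈ Icc (0 : ℝ) 1) : fund μ a b l x = fundSeries μ a b l x := by
  have hc := hμ.continuous_primitive (hμ.continuous_fundSeries a b l)
  rw [hμ.fundSeries_eq a b l hx, fund, volterra, ← intervalIntegral.integral_const_mul,
    add_sub_assoc]
  congr 1
  have : b * x = ∫ _t in (0 : ℝ)..x, b := by simp [mul_comm]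
  rw [this, ← intervalIntegral.integral_sub (Continuous.intervalIntegrable (by fun_prop) _ _)
    (Continuous.intervalIntegrable (by fun_prop) _ _)]
  refine integral_congr fun t ht => ?_
  rw [uIcc_of_le hx.1] at ht
  rw [fundDeriv, clamp_eq ⟨ht.1, ht.2.trans hx.2⟩]

@[simp] theorem fund_zero (μ : Measure ℝ) (a b l : ℝ) : fund μ a b l 0 = a := by simp [fund]

@[simp] theorem fundDeriv_zero (μ : Measure ℝ) (a b l : ℝ) : fundDeriv μ a b l 0 = b := by
  simp [fundDeriv, clamp]

/-- Series bounds are available only on [0,1]. Clamping makes the derivative continuous on the whole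
line, so `fund` is globally C¹ and no one-sided derivatives occur; on [0,1] it agrees with the
series. -/
theorem IsNonatomicProb.isSol_fund (hμ : IsNonatomicProb μ) (a b l : ℝ) :
    IsSol μ l (fund μ a b l) (fundDeriv μ a b l) where
  hasDerivAt x := by
    have hc := hμ.continuous_fundDeriv a b l
    exact (integral_hasDerivAt_right (hc.intervalIntegrable _ _)
      (hc.stronglyMeasurableAtFilter _ _) hc.continuousAt).const_add a
  continuous_deriv := hμ.continuous_fundDeriv a b l
  deriv_eq x hx := by
    rw [fundDeriv_zero, fundDeriv, clamp_eq hx]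
    congr 2
    refine integral_congr fun t ht => ?_
    rw [uIcc_of_le hx.1] at ht
    have ht' : t ∈ Icc (0 : ℝ) 1 := ⟨ht.1, ht.2.trans hx.2⟩
    rw [clamp_eq ht', hμ.fund_eq_fundSeries a b l ht']

theorem IsNonatomicProb.cp_eq_fund (hμ : IsNonatomicProb μ) {l : ℝ} (hl : 0 ≤ l) {x : ℝ}
    (hx : x ∈ Icc (0 : ℝ) 1) : cp μ √l x = fund μ 1 0 l x := by
  rw [hμ.fund_eq_fundSeries 1 0 l hx, cp, fundSeries]
  refine tsum_congr fun n => ?_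
  rw [p_even, pow_mul, Real.sq_sqrt hl, ← mul_pow, neg_one_mul]
  simp

/-- The odd powers of z leave one factor √l outside the series in l. For the Dirichlet
eigenfunctions this factor varies with the measure too and needs its own estimate. -/
theorem IsNonatomicProb.sq_eq_fund (hμ : IsNonatomicProb μ) {l : ℝ} (hl : 0 ≤ l) {x : ℝ}
    (hx : x ∈ Icc (0 : ℝ) 1) : sq μ √l x = √l * fund μ 0 1 l x := by
  rw [hμ.fund_eq_fundSeries 0 1 l hx, sq, fundSeries, ← tsum_mul_left]
  refine tsum_congr fun n => ?_
  rw [q_odd, pow_succ, pow_mul, Real.sq_sqrt hl, ← mul_assoc ((-1) ^ n), ← mul_pow, neg_one_mul]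
  simp only [zero_add, one_mul]
  ring

end

end KreinFeller

/-! ### Increasing enumeration of an infinite set that is finite below every level. -/

namespace KreinFeller

open Topology

section Enumeration

variable {S : Set ℝ}

/-- Finiteness of every lower section includes boundedness below, so the infimum is the minimum of a
finite nonempty section. -/
theorem isLeast_sInf_of_finite_Iic {T : Set ℝ} (hT : T.Nonempty) (hfin : ∀ R, (T ∩ Iic R).Finite) :
    IsLeast T (sInf T) := by
  obtain ⟨t, ht⟩ := hT
  obtain ⟨a, ⟨haT, hat⟩, hmin⟩ :=
    (T ∩ Iic t).exists_min_image id (hfin t) ⟨t, ht, le_refl t⟩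
  have : IsLeast T a := ⟨haT, fun b hb => by
    rcases le_total b t with h | h
    · exact hmin b ⟨hb, h⟩
    · exact le_trans hat h⟩
  rwa [this.csInf_eq]

theorem nonempty_inter_Ioi (hinf : S.Infinite) (hfin : ∀ R, (S ∩ Iic R).Finite) (R : ℝ) :
    (S ∩ Ioi R).Nonempty := by
  by_contra h
  rw [not_nonempty_iff_eq_empty] at h
  refine hinf ((hfin R).subset fun s hs => ⟨hs, ?_⟩)
  by_contra hlt
  have : s ∈ S ∩ Ioi R := ⟨hs, mem_Ioi.2 (not_le.1 hlt)⟩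
  rw [h] at this
  exact this

theorem isLeast_nthSmallest_zero (hinf : S.Infinite) (hfin : ∀ R, (S ∩ Iic R).Finite) :
    IsLeast S (nthSmallest S 0) :=
  isLeast_sInf_of_finite_Iic hinf.nonempty hfin

theorem isLeast_nthSmallest_succ (hinf : S.Infinite) (hfin : ∀ R, (S ∩ Iic R).Finite) (m : ℕ) :
    IsLeast (S ∩ Ioi (nthSmallest S m)) (nthSmallest S (m + 1)) :=
  isLeast_sInf_of_finite_Iic (nonempty_inter_Ioi hinf hfin _) fun R =>
    (hfin R).subset fun _ hs => ⟨hs.1.1, hs.2⟩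

theorem nthSmallest_mem (hinf : S.Infinite) (hfin : ∀ R, (S ∩ Iic R).Finite) (m : ℕ) :
    nthSmallest S m ∈ S := by
  cases m with
  | zero => exact (isLeast_nthSmallest_zero hinf hfin).1
  | succ m => exact (isLeast_nthSmallest_succ hinf hfin m).1.1

theorem strictMono_nthSmallest (hinf : S.Infinite) (hfin : ∀ R, (S ∩ Iic R).Finite) :
    StrictMono (nthSmallest S) :=
  strictMono_nat_of_lt_succ fun m => (isLeast_nthSmallest_succ hinf hfin m).1.2

/-- An element that is missed would, by induction, lie above every enumerated one, leaving
infinitely many elements below it. -/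
theorem range_nthSmallest (hinf : S.Infinite) (hfin : ∀ R, (S ∩ Iic R).Finite) :
    range (nthSmallest S) = S := by
  refine Subset.antisymm (range_subset_iff.2 (nthSmallest_mem hinf hfin)) fun s hs => ?_
  by_contra hne
  have hne' : ∀ m, nthSmallest S m ≠ s := fun m h => hne ⟨m, h⟩
  have hlt : ∀ m, nthSmallest S m < s := by
    intro m
    induction m with
    | zero => exact lt_of_le_of_ne ((isLeast_nthSmallest_zero hinf hfin).2 hs) (hne' 0)
    | succ m ih =>
      exact lt_of_le_of_ne ((isLeast_nthSmallest_succ hinf hfin m).2 ⟨hs, ih⟩) (hne' _)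
  exact (infinite_range_of_injective (strictMono_nthSmallest hinf hfin).injective)
    ((hfin s).subset (range_subset_iff.2 fun m => ⟨nthSmallest_mem hinf hfin m, (hlt m).le⟩))

end Enumeration

/-- The characteristic function `χ` of a self-adjoint boundary value problem, with the
complementary boundary value `A` and the `L₂` pairing `J` of solutions, tied together by the
Lagrange identity. -/
structure CharData (χ A : ℝ → ℝ) (J : ℝ → ℝ → ℝ) : Prop where
  continuous : Continuous χ
  continuous_pairing : Continuous fun z : ℝ × ℝ => J z.1 z.2
  pos : ∀ l, 0 < J l l
  lagrange : ∀ l k, A l * χ k - χ l * A k = (k - l) * J l k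

/-! ### Isolation, interlacing and stability of zeros, from the Lagrange identity alone. -/

namespace CharData

variable {χ A : ℝ → ℝ} {J : ℝ → ℝ → ℝ}

/-- Continuity of J at (a, a). This lower bound plays the role of a nonzero derivative of χ at its
zeros; χ is never differentiated. -/
theorem exists_pairing_ge (h : CharData χ A J) (a : ℝ) :
    ∃ ε > 0, ∀ k k', |k - a| ≤ ε → |k' - a| ≤ ε → J a a / 2 ≤ J k k' := by
  have ht : ∀ᶠ z : ℝ × ℝ in 𝓝 (a, a), J a a / 2 < J z.1 z.2 :=
    h.continuous_pairing.continuousAt.eventually_const_lt (half_lt_self (h.pos a))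
  obtain ⟨r, hr, hball⟩ := Metric.eventually_nhds_iff_ball.1 ht
  refine ⟨r / 2, by positivity, fun k k' hk hk' => (hball (k, k') ?_).le⟩
  rw [Metric.mem_ball, Prod.dist_eq, max_lt_iff, Real.dist_eq, Real.dist_eq]
  exact ⟨by linarith, by linarith⟩

/-- An exact substitute for the first-order expansion of χ at the zero a. -/
theorem mul_eq (h : CharData χ A J) {a : ℝ} (ha : χ a = 0) (k : ℝ) :
    A a * χ k = (k - a) * J a k := by
  have := h.lagrange a k
  rwa [ha, zero_mul, sub_zero] at this

theorem pairing_eq_zero (h : CharData χ A J) {a b : ℝ} (ha : χ a = 0) (hb : χ b = 0)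
    (hab : a ≠ b) : J a b = 0 := by
  have := h.mul_eq ha b
  rw [hb, mul_zero, eq_comm, mul_eq_zero] at this
  exact this.resolve_left (sub_ne_zero.2 hab.symm)

/-- An accumulation point c of zeros is a zero by closedness. Zeros y ≠ c have J(c, y) = 0,
contradicting J(c, y) ≥ J(c, c)/2 near c. -/
theorem finite_zeros (h : CharData χ A J) (a b : ℝ) : ({l | χ l = 0} ∩ Icc a b).Finite := by
  by_contra hinf
  obtain ⟨c, hc, hacc⟩ := Set.Infinite.exists_accPt_of_subset_isCompact hinf isCompact_Icc
    inter_subset_right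
  obtain ⟨ε, hε, hJ⟩ := h.exists_pairing_ge c
  have hclosed : IsClosed {l | χ l = 0} := isClosed_eq h.continuous continuous_const
  have hc0 : χ c = 0 := by
    have := hacc.clusterPt.mono (principal_mono.2 inter_subset_left)
    exact isClosed_iff_clusterPt.1 hclosed c this
  rw [accPt_iff_nhds] at hacc
  obtain ⟨y, ⟨hy, hy0, -⟩, hyc⟩ := hacc _ (Metric.ball_mem_nhds c hε)
  have h1 := hJ c y (by simpa using hε.le) (Metric.mem_ball.1 hy).le
  rw [h.pairing_eq_zero hc0 hy0 hyc.symm] at h1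
  have := h.pos c
  linarith

theorem finite_zeros_Iic (h : CharData χ A J) (hnn : ∀ l, χ l = 0 → 0 ≤ l) (R : ℝ) :
    ({l | χ l = 0} ∩ Iic R).Finite :=
  (h.finite_zeros 0 R).subset fun l hl => ⟨hl.1, hnn l hl.1, hl.2⟩

/-- Otherwise (k - a) J(a, k) = 0 for all k, while J(a, k) > 0 for k near a. -/
theorem complement_ne_zero (h : CharData χ A J) {a : ℝ} (ha : χ a = 0) : A a ≠ 0 := by
  intro hA
  obtain ⟨ε, hε, hJ⟩ := h.exists_pairing_ge a
  have h1 := h.mul_eq ha (a + ε)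
  have h2 := hJ a (a + ε) (by simpa using hε.le) (by simp [abs_of_pos hε])
  have := h.pos a
  rw [hA, zero_mul, add_sub_cancel_left, eq_comm, mul_eq_zero] at h1
  rcases h1 with h1 | h1 <;> linarith

/-- If `Z` has the sign of the complementary boundary value at each zero of `χ`, then it has a
zero between consecutive zeros of `χ`. -/
theorem infinite_zeros_of_interlacing (h : CharData χ A J) (hnn : ∀ l, χ l = 0 → 0 ≤ l)
    (hinf : {l | χ l = 0}.Infinite) {Z : ℝ → ℝ} (hZ : Continuous Z)
    (hsign : ∀ l, χ l = 0 → 0 < Z l * A l) : {l | Z l = 0}.Infinite := by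
  have hfin := h.finite_zeros_Iic hnn
  set y := nthSmallest {l | χ l = 0} with hy
  have hmono := strictMono_nthSmallest hinf hfin
  have hmem : ∀ k, χ (y k) = 0 := nthSmallest_mem hinf hfin
  have hgap : ∀ k, ∀ x ∈ Ioo (y k) (y (k + 1)), χ x ≠ 0 := fun k x hx h0 =>
    not_lt.2 ((isLeast_nthSmallest_succ hinf hfin k).2 ⟨h0, hx.1⟩) hx.2
  -- By `mul_eq`, χ has the sign of A(y k) just to the right of y k and the sign opposite to A(y
  -- (k+1)) just to the left of y (k+1). There is no zero in between, so A alternates. Steps of at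
  -- most half the gap keep x₁ ≤ x₂.
  have hneg : ∀ k, A (y k) * A (y (k + 1)) < 0 := by
    intro k
    have hlt : y k < y (k + 1) := hmono (Nat.lt_succ_self k)
    obtain ⟨ε₁, hε₁, hJ₁⟩ := h.exists_pairing_ge (y k)
    obtain ⟨ε₂, hε₂, hJ₂⟩ := h.exists_pairing_ge (y (k + 1))
    set d := (y (k + 1) - y k) / 2 with hd
    have hd0 : 0 < d := by rw [hd]; linarith
    set x₁ := y k + min ε₁ d with hx₁
    set x₂ := y (k + 1) - min ε₂ d with hx₂
    have m₁ : 0 < min ε₁ d := lt_min hε₁ hd0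
    have m₂ : 0 < min ε₂ d := lt_min hε₂ hd0
    have m₁' := min_le_right ε₁ d
    have m₂' := min_le_right ε₂ d
    have p₁ : 0 < A (y k) * χ x₁ := by
      rw [h.mul_eq (hmem k)]
      have := hJ₁ (y k) x₁ (by simpa using hε₁.le)
        (by rw [hx₁, add_sub_cancel_left, abs_of_pos m₁]; exact min_le_left _ _)
      have := h.pos (y k)
      have : 0 < x₁ - y k := by rw [hx₁]; linarith
      apply mul_pos <;> linarith
    have p₂ : A (y (k + 1)) * χ x₂ < 0 := by
      rw [h.mul_eq (hmem (k + 1))]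
      have := hJ₂ (y (k + 1)) x₂ (by simpa using hε₂.le)
        (by rw [hx₂, sub_sub_cancel_left, abs_neg, abs_of_pos m₂]; exact min_le_left _ _)
      have := h.pos (y (k + 1))
      have : x₂ - y (k + 1) < 0 := by rw [hx₂]; linarith
      apply mul_neg_of_neg_of_pos <;> linarith
    have hle : x₁ ≤ x₂ := by linarith
    have p₃ : 0 < χ x₁ * χ x₂ := by
      by_contra! hcon
      have hivt : ∃ x ∈ Icc x₁ x₂, χ x = 0 := by
        rcases le_total (χ x₁) 0 with h0 | h0
        · have : 0 ≤ χ x₂ := by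
            by_contra! hc
            have : χ x₁ ≠ 0 := fun hc' => by simp [hc'] at p₁
            have := mul_pos_of_neg_of_neg (lt_of_le_of_ne h0 this) hc
            linarith
          exact intermediate_value_Icc hle h.continuous.continuousOn ⟨h0, this⟩
        · have : χ x₂ ≤ 0 := by
            by_contra! hc
            have : χ x₁ ≠ 0 := fun hc' => by simp [hc'] at p₁
            have := mul_pos (lt_of_le_of_ne h0 this.symm) hc
            linarith
          exact intermediate_value_Icc' hle h.continuous.continuousOn ⟨this, h0⟩
      obtain ⟨x, hx, hx0⟩ := hivt
      exact hgap k x ⟨by linarith [hx.1], by linarith [hx.2]⟩ hx0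
    have p₄ : A (y k) * A (y (k + 1)) * (χ x₁ * χ x₂) < 0 := by
      have := mul_neg_of_pos_of_neg p₁ p₂
      linarith
    exact neg_of_mul_neg_left p₄ p₃.le
  have hz : ∀ k, ∃ z ∈ Icc (y k) (y (k + 1)), Z z = 0 := by
    intro k
    have hle : y k ≤ y (k + 1) := (hmono (Nat.lt_succ_self k)).le
    have s₁ := hsign _ (hmem k)
    have s₂ := hsign _ (hmem (k + 1))
    have hn := hneg k
    have hZn : Z (y k) * Z (y (k + 1)) < 0 := by
      have : 0 < Z (y k) * Z (y (k + 1)) * (A (y k) * A (y (k + 1))) := by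
        have := mul_pos s₁ s₂; linarith
      exact neg_of_mul_pos_left this hn.le
    rcases mul_neg_iff.1 hZn with ⟨c₁, c₂⟩ | ⟨c₁, c₂⟩
    · exact intermediate_value_Icc' hle hZ.continuousOn ⟨c₂.le, c₁.le⟩
    · exact intermediate_value_Icc hle hZ.continuousOn ⟨c₁.le, c₂.le⟩
  choose z hz hz0 using hz
  -- Neighbouring closed intervals share an endpoint; the sign condition excludes it as a zero of Z,
  -- so the chosen zeros are distinct.
  have hzy : ∀ k, z k ≠ y (k + 1) := by
    intro k hk
    have := hsign _ (hmem (k + 1))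
    rw [← hk, hz0 k, zero_mul] at this
    exact lt_irrefl _ this
  have hzm : StrictMono z := strictMono_nat_of_lt_succ fun k =>
    (lt_of_le_of_ne (hz k).2 (hzy k)).trans_le (hz (k + 1)).1
  exact (infinite_range_of_injective hzm.injective).mono (range_subset_iff.2 hz0)

/-- `χ'` and `J'` are within `d` of `χ` and `J` for spectral parameters in `[-R, R]`. -/
def Close (R d : ℝ) (χ χ' : ℝ → ℝ) (J J' : ℝ → ℝ → ℝ) : Prop :=
  (∀ l, |l| ≤ R → |χ' l - χ l| ≤ d) ∧ ∀ l k, |l| ≤ R → |k| ≤ R → |J' l k - J l k| ≤ d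

/-- A(a) χ(a ± r) = ± r J(a, a ± r) has modulus at least r J(a, a)/2. A perturbation of at most that
size keeps the two weak signs, and the intermediate value theorem applies to A(a) χ'. -/
theorem exists_zero_near (h : CharData χ A J) {a : ℝ} (ha : χ a = 0) {R : ℝ} (haR : |a| + 1 ≤ R)
    {ε : ℝ} (hε : 0 < ε) :
    ∃ d₀ > 0, ∀ χ' A' J', CharData χ' A' J' → Close R d₀ χ χ' J J' →
      ∃ x, |x - a| ≤ ε ∧ χ' x = 0 := by
  obtain ⟨ε₁, hε₁, hJ⟩ := h.exists_pairing_ge a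
  set r := min (min ε ε₁) 1 with hr
  have hr0 : 0 < r := lt_min (lt_min hε hε₁) one_pos
  have hrε : r ≤ ε := (min_le_left _ _).trans (min_le_left _ _)
  have hrε₁ : r ≤ ε₁ := (min_le_left _ _).trans (min_le_right _ _)
  have hr1 : r ≤ 1 := min_le_right _ _
  have hA := h.complement_ne_zero ha
  have hpos := h.pos a
  refine ⟨r * (J a a / 2) / |A a|, by positivity, fun χ' A' J' h' hclose => ?_⟩
  have bd : ∀ x, |x - a| ≤ 1 → |A a * χ' x - (x - a) * J a x| ≤ r * (J a a / 2) := by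
    intro x hx
    rw [← h.mul_eq ha x, ← mul_sub, abs_mul]
    have hxR : |x| ≤ R := by
      have := abs_add_le (x - a) a
      rw [sub_add_cancel] at this
      linarith
    have := mul_le_mul_of_nonneg_left (hclose.1 x hxR) (abs_nonneg (A a))
    rwa [mul_div_cancel₀ _ (abs_ne_zero.2 hA)] at this
  have b₁ := bd (a + r) (by rw [add_sub_cancel_left, abs_of_pos hr0]; exact hr1)
  have b₂ := bd (a - r) (by rw [sub_sub_cancel_left, abs_neg, abs_of_pos hr0]; exact hr1)
  have j₁ := hJ a (a + r) (by simpa using hε₁.le)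
    (by rw [add_sub_cancel_left, abs_of_pos hr0]; exact hrε₁)
  have j₂ := hJ a (a - r) (by simpa using hε₁.le)
    (by rw [sub_sub_cancel_left, abs_neg, abs_of_pos hr0]; exact hrε₁)
  rw [add_sub_cancel_left, abs_le] at b₁
  rw [sub_sub_cancel_left, abs_le] at b₂
  have c₁ : 0 ≤ A a * χ' (a + r) := by nlinarith [mul_le_mul_of_nonneg_left j₁ hr0.le]
  have c₂ : A a * χ' (a - r) ≤ 0 := by nlinarith [mul_le_mul_of_nonneg_left j₂ hr0.le]
  obtain ⟨x, hx, hx0⟩ := intermediate_value_Icc (by linarith : a - r ≤ a + r)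
    ((h'.continuous.const_mul (A a)).continuousOn) ⟨c₂, c₁⟩
  refine ⟨x, ?_, (mul_eq_zero.1 hx0).resolve_left hA⟩
  rw [abs_le]
  constructor <;> linarith [hx.1, hx.2]

/-- Two distinct zeros of χ' would be orthogonal for J', but near a one has J ≥ J(a, a)/2 and J' is
within J(a, a)/4 of J. -/
theorem exists_unique_near (h : CharData χ A J) (a : ℝ) {R : ℝ} (haR : |a| + 1 ≤ R) :
    ∃ ε > 0, ∃ d₀ > 0, ∀ χ' A' J', CharData χ' A' J' → Close R d₀ χ χ' J J' →
      ∀ x y, |x - a| ≤ ε → |y - a| ≤ ε → χ' x = 0 → χ' y = 0 → x = y := by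
  obtain ⟨ε₁, hε₁, hJ⟩ := h.exists_pairing_ge a
  have hpos := h.pos a
  refine ⟨min ε₁ 1, lt_min hε₁ one_pos, J a a / 4, by positivity,
    fun χ' A' J' h' hclose x y hx hy hx0 hy0 => ?_⟩
  have hR : ∀ z, |z - a| ≤ min ε₁ 1 → |z| ≤ R := by
    intro z hz
    have := abs_add_le (z - a) a
    rw [sub_add_cancel] at this
    linarith [min_le_right ε₁ 1]
  by_contra hxy
  have h1 := hclose.2 x y (hR x hx) (hR y hy)
  rw [h'.pairing_eq_zero hx0 hy0 hxy, abs_le] at h1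
  have h2 := hJ x y (hx.trans (min_le_left _ _)) (hy.trans (min_le_left _ _))
  linarith [h1.1]

theorem exists_ne_zero_on (h : CharData χ A J) {x y R : ℝ} (hR : ∀ z ∈ Icc x y, |z| ≤ R)
    (hne : ∀ z ∈ Icc x y, χ z ≠ 0) :
    ∃ d₀ > 0, ∀ χ' J', Close R d₀ χ χ' J J' → ∀ z ∈ Icc x y, χ' z ≠ 0 := by
  obtain hemp | hnemp := (Icc x y).eq_empty_or_nonempty
  · exact ⟨1, one_pos, fun _ _ _ z hz => by simp [hemp] at hz⟩
  obtain ⟨z₀, hz₀, hmin⟩ := isCompact_Icc.exists_isMinOn hnemp h.continuous.abs.continuousOn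
  have hpos : 0 < |χ z₀| := abs_pos.2 (hne z₀ hz₀)
  refine ⟨|χ z₀| / 2, by positivity, fun χ' J' hc z hz h0 => ?_⟩
  have h1 := hc.1 z (hR z hz)
  have h2 : |χ z₀| ≤ |χ z| := hmin hz
  rw [h0, zero_sub, abs_neg] at h1
  linarith

theorem Close.mono {R d d' : ℝ} {χ χ' : ℝ → ℝ} {J J' : ℝ → ℝ → ℝ} (h : Close R d χ χ' J J')
    (hd : d ≤ d') : Close R d' χ χ' J J' :=
  ⟨fun l hl => (h.1 l hl).trans hd, fun l k hl hk => (h.2 l k hl hk).trans hd⟩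

/-- The `i`-th zero depends continuously on the data. -/
theorem nthSmallest_close (h : CharData χ A J) (hnn : ∀ l, χ l = 0 → 0 ≤ l)
    (hinf : {l | χ l = 0}.Infinite) {R : ℝ} (i : ℕ)
    (hiR : nthSmallest {l | χ l = 0} i + 1 ≤ R) {ε : ℝ} (hε : 0 < ε) :
    ∃ d₀ > 0, ∀ χ' A' J', CharData χ' A' J' → (∀ l, χ' l = 0 → 0 ≤ l) →
      {l | χ' l = 0}.Infinite → Close R d₀ χ χ' J J' →
      |nthSmallest {l | χ' l = 0} i - nthSmallest {l | χ l = 0} i| ≤ ε := by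
  have hfin := h.finite_zeros_Iic hnn
  set y := nthSmallest {l | χ l = 0} with hy
  have hmem : ∀ k, χ (y k) = 0 := nthSmallest_mem hinf hfin
  have hy0 : ∀ k, 0 ≤ y k := fun k => hnn _ (hmem k)
  induction i generalizing ε with
  | zero =>
    obtain ⟨d₁, hd₁, H₁⟩ := h.exists_zero_near (hmem 0) (R := R)
      (by rwa [abs_of_nonneg (hy0 0)]) hε
    obtain ⟨d₂, hd₂, H₂⟩ := h.exists_ne_zero_on (x := 0) (y := y 0 - ε) (R := R)
      (fun z hz => by rw [abs_of_nonneg hz.1]; linarith [hz.2]) (fun z hz h0 => by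
        have : y 0 ≤ z := (isLeast_nthSmallest_zero hinf hfin).2 h0
        linarith [hz.2])
    refine ⟨min d₁ d₂, lt_min hd₁ hd₂, fun χ' A' J' h' hnn' hinf' hc => ?_⟩
    have hfin' := h'.finite_zeros_Iic hnn'
    obtain ⟨x, hx, hx0⟩ := H₁ χ' A' J' h' (hc.mono (min_le_left _ _))
    have hl := isLeast_nthSmallest_zero hinf' hfin'
    have u1 := hl.2 hx0
    have u2 : y 0 - ε < nthSmallest {l | χ' l = 0} 0 := by
      by_contra! hcon
      exact H₂ χ' J' (hc.mono (min_le_right _ _)) _ ⟨hnn' _ hl.1, hcon⟩ hl.1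
    rw [abs_le] at hx ⊢
    constructor <;> linarith [hx.1, hx.2]
  | succ i ih =>
    -- The i-th perturbed zero lies within s of y i by induction. The next one cannot be there too
    -- (`H₂`), nor between y i + s and y (i+1) - ε (`H₃`), while a perturbed zero exists near y
    -- (i+1) (`H₁`). Radii of at most a third of the gap put that zero above the i-th one.
    have hlt : y i < y (i + 1) := strictMono_nthSmallest hinf hfin (Nat.lt_succ_self i)
    obtain ⟨d₁, hd₁, H₁⟩ := h.exists_zero_near (hmem (i + 1)) (R := R)
      (by rwa [abs_of_nonneg (hy0 _)]) (ε := min ε ((y (i + 1) - y i) / 3))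
      (lt_min hε (by linarith))
    obtain ⟨r, hr, d₂, hd₂, H₂⟩ := h.exists_unique_near (y i) (R := R)
      (by rw [abs_of_nonneg (hy0 _)]; linarith)
    set s := min r ((y (i + 1) - y i) / 3) with hs
    have hs0 : 0 < s := lt_min hr (by linarith)
    have hsr : s ≤ r := min_le_left _ _
    have hsd : s ≤ (y (i + 1) - y i) / 3 := min_le_right _ _
    obtain ⟨d₃, hd₃, H₃⟩ := h.exists_ne_zero_on (x := y i + s) (y := y (i + 1) - ε) (R := R)
      (fun z hz => by rw [abs_of_nonneg] <;> linarith [hz.1, hz.2, hy0 i]) (fun z hz h0 => by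
        have : y (i + 1) ≤ z := (isLeast_nthSmallest_succ hinf hfin i).2
          ⟨h0, mem_Ioi.2 (by linarith [hz.1])⟩
        linarith [hz.2])
    obtain ⟨d₄, hd₄, H₄⟩ := ih hs0 (by linarith)
    refine ⟨min (min d₁ d₂) (min d₃ d₄), by positivity, fun χ' A' J' h' hnn' hinf' hc => ?_⟩
    have hc₁ := hc.mono ((min_le_left _ _).trans (min_le_left _ _))
    have hc₂ := hc.mono ((min_le_left _ _).trans (min_le_right _ _))
    have hc₃ := hc.mono ((min_le_right _ _).trans (min_le_left _ _))
    have hc₄ := hc.mono ((min_le_right _ _).trans (min_le_right _ _))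
    have hfin' := h'.finite_zeros_Iic hnn'
    have hprev := H₄ χ' A' J' h' hnn' hinf' hc₄
    have hprev0 : χ' (nthSmallest {l | χ' l = 0} i) = 0 := nthSmallest_mem hinf' hfin' i
    obtain ⟨x, hx, hx0⟩ := H₁ χ' A' J' h' hc₁
    have hxε := hx.trans (min_le_left _ _)
    have hxd := hx.trans (min_le_right _ _)
    have hl := isLeast_nthSmallest_succ hinf' hfin' i
    set z := nthSmallest {l | χ' l = 0} (i + 1)
    set z' := nthSmallest {l | χ' l = 0} i
    have hzz' : z' < z := hl.1.2
    rw [abs_le] at hxd hxε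
    have hp := abs_le.1 hprev
    have u1 : z ≤ x := hl.2 ⟨hx0, mem_Ioi.2 (by linarith [hxd.1, hp.2])⟩
    have u2 : y i + s < z := by
      by_contra! hcon
      refine hzz'.ne (H₂ χ' A' J' h' hc₂ z' z (hprev.trans hsr) ?_ hprev0 hl.1.1)
      rw [abs_le]
      constructor <;> linarith [hp.1]
    have u3 : y (i + 1) - ε < z := by
      by_contra! hcon
      exact H₃ χ' J' hc₃ z ⟨u2.le, hcon⟩ hl.1.1
    rw [abs_le]
    constructor <;> linarith [hxε.2]

/-- The `i`-th zero is Lipschitz in the data. -/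
theorem nthSmallest_lipschitz (h : CharData χ A J) (hnn : ∀ l, χ l = 0 → 0 ≤ l)
    (hinf : {l | χ l = 0}.Infinite) {R : ℝ} (i : ℕ)
    (hiR : nthSmallest {l | χ l = 0} i + 1 ≤ R) :
    ∃ c > 0, ∃ d₀ > 0, ∀ χ' A' J', CharData χ' A' J' → (∀ l, χ' l = 0 → 0 ≤ l) →
      {l | χ' l = 0}.Infinite → ∀ d ≤ d₀, Close R d χ χ' J J' →
      nthSmallest {l | χ' l = 0} i ≤ R ∧
      |nthSmallest {l | χ' l = 0} i - nthSmallest {l | χ l = 0} i| ≤ c * d := by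
  have hfin := h.finite_zeros_Iic hnn
  set a := nthSmallest {l | χ l = 0} i with ha
  have ha0 : χ a = 0 := nthSmallest_mem hinf hfin i
  obtain ⟨ε, hε, hJ⟩ := h.exists_pairing_ge a
  obtain ⟨d₀, hd₀, H⟩ := h.nthSmallest_close hnn hinf i hiR (lt_min hε one_pos)
  have hpos := h.pos a
  have hA := abs_pos.2 (h.complement_ne_zero ha0)
  refine ⟨|A a| / (J a a / 2), by positivity, d₀, hd₀, fun χ' A' J' h' hnn' hinf' d hd hc => ?_⟩
  have h1 := H χ' A' J' h' hnn' hinf' (hc.mono hd)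
  set b := nthSmallest {l | χ' l = 0} i
  have hb0 : χ' b = 0 := nthSmallest_mem hinf' (h'.finite_zeros_Iic hnn') i
  have hbR : b ≤ R := by
    have := (abs_le.1 (h1.trans (min_le_right _ _))).2
    linarith
  refine ⟨hbR, ?_⟩
  have h2 := hJ a b (by simpa using hε.le) (h1.trans (min_le_left _ _))
  have h3 := hc.1 b (by rwa [abs_of_nonneg (hnn' b hb0)])
  rw [hb0, zero_sub, abs_neg] at h3
  -- (b - a) J(a, b) = A(a) χ(b), and |χ(b)| ≤ d because χ'(b) = 0; dividing by J(a, b) ≥ J(a, a)/2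
  -- gives the constant.
  have h4 := congrArg abs (h.mul_eq ha0 b)
  rw [abs_mul, abs_mul, abs_of_pos (show 0 < J a b by linarith)] at h4
  rw [div_mul_eq_mul_div, le_div_iff₀ (by positivity)]
  calc |b - a| * (J a a / 2) ≤ |b - a| * J a b := by gcongr
    _ = |A a| * |χ b| := h4.symm
    _ ≤ |A a| * d := by gcongr

end CharData

end KreinFeller

/-! ### Infinitely many eigenvalues of the mixed problem via a compact operator. -/

namespace KreinFeller

open Topology

section CurveOperator

variable {H : Type*} [NormedAddCommGroup H] [InnerProductSpace ℝ H] {e : ℝ → H}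

/-- The operator `∫₀¹ e(t) ⊗ e(t) dt` of a curve `e` in a Hilbert space. -/
noncomputable def curveOp (e : ℝ → H) : H →L[ℝ] H :=
  ∫ t in Ioc (0 : ℝ) 1, InnerProductSpace.rankOne ℝ (e t) (e t)

theorem integrable_rankOne_curve (he : Continuous e) :
    IntegrableOn (fun t => InnerProductSpace.rankOne ℝ (e t) (e t)) (Ioc (0 : ℝ) 1) := by
  have hc : Continuous fun t => InnerProductSpace.rankOne ℝ (e t) (e t) :=
    ((InnerProductSpace.rankOne ℝ (E := H) (F := H)).continuous.comp he).clm_apply he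
  exact hc.integrableOn_Icc.mono_set Ioc_subset_Icc_self

/-- An average of rank-one operators over a probability space stays in the closed convex set of
compact operators. -/
theorem isCompactOperator_curveOp [CompleteSpace H] (he : Continuous e) : IsCompactOperator (curveOp e) := by
  have : IsProbabilityMeasure (volume.restrict (Ioc (0 : ℝ) 1)) := ⟨by simp⟩
  refine Convex.integral_mem (s := {T : H →L[ℝ] H | IsCompactOperator T})
    (compactOperator (RingHom.id ℝ) H H).convex isClosed_setOfPred_isCompactOperator
    (Eventually.of_forall fun t => ?_) (integrable_rankOne_curve he)
  change IsCompactOperator (InnerProductSpace.rankOne ℝ (e t) (e t))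
  rw [InnerProductSpace.rankOne_def']
  exact (isCompactOperator_of_locallyCompactSpace_rng
    (ContinuousLinearMap.toSpanSingleton ℝ (e t))).comp_clm _

theorem inner_curveOp [CompleteSpace H] (he : Continuous e) (f g : H) :
    inner ℝ g (curveOp e f) = ∫ t in (0 : ℝ)..1, inner ℝ (e t) f * inner ℝ (e t) g := by
  have hc : Continuous fun t => inner ℝ (e t) f • e t := (he.inner continuous_const).smul he
  rw [curveOp, ContinuousLinearMap.integral_apply (integrable_rankOne_curve he),
    intervalIntegral.integral_of_le zero_le_one]
  simp only [InnerProductSpace.rankOne_apply]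
  rw [← integral_inner (hc.integrableOn_Icc.mono_set Ioc_subset_Icc_self)]
  refine integral_congr_ae (Eventually.of_forall fun t => ?_)
  simp only [inner_smul_right, real_inner_comm g]

theorem isSymmetric_curveOp [CompleteSpace H] (he : Continuous e) :
    ((curveOp e : H →L[ℝ] H) : H →ₗ[ℝ] H).IsSymmetric := by
  intro f g
  simp only [ContinuousLinearMap.coe_coe]
  rw [real_inner_comm, inner_curveOp he, inner_curveOp he]
  simp only [mul_comm]

/-- Pairing with f gives ∫ ⟨e(t), f⟩² dt = 0, and the integrand is continuous. -/
theorem inner_eq_zero_of_curveOp_eq_zero [CompleteSpace H] (he : Continuous e) {f : H} (hf : curveOp e f = 0) :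
    ∀ t ∈ Icc (0 : ℝ) 1, inner ℝ (e t) f = 0 := by
  have h0 := inner_curveOp he f f
  rw [hf, inner_zero_right] at h0
  have hc : Continuous fun t => inner ℝ (e t) f := he.inner continuous_const
  by_contra! hcon
  obtain ⟨t, ht, hne⟩ := hcon
  refine h0.not_lt (intervalIntegral.integral_pos zero_lt_one (hc.mul hc).continuousOn
    (fun _ _ => mul_self_nonneg _) ⟨t, ht, mul_self_pos.2 hne⟩)

/-- If the nonzero eigenvectors of `curveOp e` lie in a finite dimensional space, so does the
curve. -/
theorem exists_finiteDimensional_curve [CompleteSpace H] (he : Continuous e)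
    (W : Submodule ℝ H) [FiniteDimensional ℝ W]
    (hW : ∀ (k : ℝ) (f : H), k ≠ 0 → curveOp e f = k • f → f ∈ W) :
    ∃ V : Submodule ℝ H, FiniteDimensional ℝ V ∧ ∀ t ∈ Icc (0 : ℝ) 1, e t ∈ V := by
  set V : Submodule ℝ H := Submodule.span ℝ {f | ∃ k : ℝ, k ≠ 0 ∧ curveOp e f = k • f} with hV
  have hVW : V ≤ W := Submodule.span_le.2 fun f ⟨k, hk, hf⟩ => hW k f hk hf
  have hfd : FiniteDimensional ℝ V := Submodule.finiteDimensional_of_le hVW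
  refine ⟨V, hfd, fun t ht => ?_⟩
  have hker : ∀ g, curveOp e g = 0 → ∀ w ∈ V, inner ℝ w g = 0 := by
    intro g hg w hw
    induction hw using Submodule.span_induction with
    | mem f hf =>
      obtain ⟨k, hk, hf⟩ := hf
      have := isSymmetric_curveOp he f g
      simp only [ContinuousLinearMap.coe_coe] at this
      rw [hf, hg, inner_zero_right, real_inner_smul_left, mul_eq_zero] at this
      exact this.resolve_left hk
    | zero => simp
    | add a b _ _ ha hb => rw [inner_add_left, ha, hb, add_zero]
    | smul c a _ ha => rw [real_inner_smul_left, ha, mul_zero]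
  -- The component r of e(t) orthogonal to V is orthogonal to every eigenspace: to the nonzero ones
  -- by choice of V, to the kernel because both e(t) and V are. The spectral theorem for compact
  -- symmetric operators then gives r = 0.
  obtain ⟨w, hw, r, hr, hsum⟩ := V.exists_add_mem_mem_orthogonal (e t)
  have hr0 : r ∈ (⨆ k, Module.End.eigenspace ((curveOp e : H →L[ℝ] H) : H →ₗ[ℝ] H) k)ᗮ := by
    rw [← Submodule.iInf_orthogonal, Submodule.mem_iInf]
    intro k f hf
    rw [Module.End.mem_eigenspace_iff, ContinuousLinearMap.coe_coe] at hf
    by_cases hk : k = 0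
    · rw [hk, zero_smul] at hf
      have h1 := inner_eq_zero_of_curveOp_eq_zero he hf t ht
      rw [hsum, inner_add_left, hker f hf w hw, zero_add] at h1
      rwa [real_inner_comm]
    · exact hr f (Submodule.subset_span ⟨k, hk, hf⟩)
  rw [ContinuousLinearMap.orthogonalComplement_iSup_eigenspaces_eq_bot
    (isCompactOperator_curveOp he) (isSymmetric_curveOp he), Submodule.mem_bot] at hr0
  rw [hsum, hr0, add_zero]
  exact hw

end CurveOperator

section TailIndicator

variable {μ : Measure ℝ}

/-- The indicator function of `(t, ∞)` in `L₂(μ)`. -/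
noncomputable def tailInd (μ : Measure ℝ) [IsFiniteMeasure μ] (t : ℝ) : Lp ℝ 2 μ :=
  indicatorConstLp 2 (measurableSet_Ioi (a := t)) (measure_ne_top μ _) (1 : ℝ)

theorem inner_tailInd [IsFiniteMeasure μ] (t : ℝ) (f : Lp ℝ 2 μ) :
    inner ℝ (tailInd μ t) f = ∫ x in Ioi t, f x ∂μ :=
  L2.inner_indicatorConstLp_one _ _ f

theorem inner_tailInd_tailInd [IsFiniteMeasure μ] (s t : ℝ) :
    inner ℝ (tailInd μ s) (tailInd μ t) = μ.real (Ioi (max s t)) := by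
  rw [tailInd, tailInd, L2.real_inner_indicatorConstLp_one_indicatorConstLp_one, Ioi_inter_Ioi]

theorem IsNonatomicProb.setIntegral_Ioi (hμ : IsNonatomicProb μ) {f : ℝ → ℝ} (hf : Integrable f μ)
    (t : ℝ) : ∫ x in Ioi t, f x ∂μ = (∫ x in (0 : ℝ)..1, f x ∂μ) - ∫ x in (0 : ℝ)..t, f x ∂μ := by
  have := hμ.nullSingletonClass
  have e1 := intervalIntegral.integral_interval_add_Ioi (a := 0) (b := t) (μ := μ)
    hf.integrableOn hf.integrableOn
  have e2 := intervalIntegral.integral_interval_add_Ioi (a := 0) (b := 1) (μ := μ)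
    hf.integrableOn hf.integrableOn
  have e3 : ∫ x in Ioi (1 : ℝ), f x ∂μ = 0 := by
    rw [Measure.restrict_eq_zero.2, integral_zero_measure]
    exact measure_mono_null (fun x (hx : 1 < x) (h : x ∈ Icc (0 : ℝ) 1) => not_lt.2 h.2 hx)
      hμ.concentrated
  linarith

theorem IsNonatomicProb.real_Ioi (hμ : IsNonatomicProb μ) (t : ℝ) :
    μ.real (Ioi t) = (∫ _x in (0 : ℝ)..1, (1 : ℝ) ∂μ) - ∫ _x in (0 : ℝ)..t, (1 : ℝ) ∂μ := by
  have := hμ.prob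
  rw [← hμ.setIntegral_Ioi (integrable_const _)]
  simp

theorem IsNonatomicProb.continuous_real_Ioi (hμ : IsNonatomicProb μ) :
    Continuous fun t => μ.real (Ioi t) := by
  simp only [hμ.real_Ioi]
  exact continuous_const.sub (hμ.continuous_primitive continuous_const)

/-- The squared distance of two tail indicators is a combination of tail masses, which are
continuous as there are no atoms. -/
theorem IsNonatomicProb.continuous_tailInd (hμ : IsNonatomicProb μ) [IsFiniteMeasure μ] :
    Continuous (tailInd μ) := by
  rw [continuous_iff_continuousAt]
  intro t
  rw [ContinuousAt, tendsto_iff_norm_sub_tendsto_zero]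
  have hG := hμ.continuous_real_Ioi
  have hn : ∀ s, ‖tailInd μ s - tailInd μ t‖ =
      √(μ.real (Ioi s) - 2 * μ.real (Ioi (max s t)) + μ.real (Ioi t)) := by
    intro s
    rw [← Real.sqrt_sq (norm_nonneg _), norm_sub_sq_real, ← real_inner_self_eq_norm_sq,
      ← real_inner_self_eq_norm_sq, inner_tailInd_tailInd, inner_tailInd_tailInd,
      inner_tailInd_tailInd, max_self, max_self]
  simp only [hn]
  have hm : Continuous fun s => μ.real (Ioi (max s t)) :=
    hG.comp (continuous_id.max continuous_const)
  have hc : Continuous fun s => √(μ.real (Ioi s) - 2 * μ.real (Ioi (max s t)) + μ.real (Ioi t)) :=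
    ((hG.sub (hm.const_mul 2)).add continuous_const).sqrt
  have := hc.tendsto t
  rw [max_self] at this
  convert this using 2
  rw [eq_comm, Real.sqrt_eq_zero']
  linarith

/-- A nonatomic measure does not admit a finite dimensional space containing the indicator
functions of all intervals. -/
theorem IsNonatomicProb.not_finiteDimensional_tailInd (hμ : IsNonatomicProb μ) [IsFiniteMeasure μ]
    (V : Submodule ℝ (Lp ℝ 2 μ)) [FiniteDimensional ℝ V]
    (hV : ∀ t ∈ Icc (0 : ℝ) 1, tailInd μ t ∈ V) : False := by
  have hprob := hμ.prob
  have hnull := hμ.nullSingletonClass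
  have hG := hμ.continuous_real_Ioi
  have h1 : μ.real (Ioi 1) = 0 := by rw [hμ.real_Ioi, sub_self]
  have h0 : μ.real (Ioi 0) = 1 := by
    rw [hμ.real_Ioi, ← hμ.integral_eq]; simp
  -- Tail masses 1 - 1/(k+1) strictly increase, so differences of consecutive tail indicators
  -- represent disjoint intervals of positive mass: an infinite orthogonal family of nonzero vectors
  -- in V.
  have hex : ∀ k : ℕ, ∃ t ∈ Icc (0 : ℝ) 1, μ.real (Ioi t) = 1 - 1 / ((k : ℝ) + 1) := by
    intro k
    have := intermediate_value_Icc' (zero_le_one' ℝ) hG.continuousOn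
    rw [h0, h1] at this
    refine this ⟨?_, ?_⟩
    · rw [sub_nonneg, div_le_one (by positivity)]
      linarith [(Nat.cast_nonneg k : (0 : ℝ) ≤ k)]
    · rw [sub_le_self_iff]; positivity
  choose t ht hGt using hex
  have hval : StrictMono fun k => μ.real (Ioi (t k)) := by
    intro i j hij
    simp only [hGt]
    have : (i : ℝ) < j := by exact_mod_cast hij
    have := one_div_lt_one_div_of_lt (by positivity : (0 : ℝ) < i + 1) (by linarith : (i : ℝ) + 1 < j + 1)
    linarith
  have hanti : StrictAnti t := by
    intro i j hij
    by_contra! hle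
    have : μ.real (Ioi (t j)) ≤ μ.real (Ioi (t i)) := measureReal_mono (Ioi_subset_Ioi hle)
    exact not_lt.2 this (hval hij)
  have hin : ∀ i j, i ≤ j → inner ℝ (tailInd μ (t i)) (tailInd μ (t j)) = μ.real (Ioi (t i)) := by
    intro i j hij
    rw [inner_tailInd_tailInd, max_eq_left (hanti.antitone hij)]
  set d : ℕ → V := fun k => ⟨tailInd μ (t (k + 1)) - tailInd μ (t k),
    V.sub_mem (hV _ (ht _)) (hV _ (ht _))⟩ with hd
  have horth : ∀ i j, i < j → inner ℝ (d i) (d j) = 0 := by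
    intro i j hij
    simp only [hd, Submodule.coe_inner, inner_sub_left, inner_sub_right]
    rw [hin _ _ (by omega), hin _ _ (by omega), hin _ _ (by omega), hin _ _ (by omega)]
    ring
  have hne : ∀ i, d i ≠ 0 := by
    intro i h
    have h2 : inner ℝ (d i) (d i) = μ.real (Ioi (t (i + 1))) - μ.real (Ioi (t i)) := by
      simp only [hd, Submodule.coe_inner, inner_sub_left, inner_sub_right]
      rw [hin _ _ le_rfl, hin _ _ le_rfl, hin _ _ (by omega : i ≤ i + 1), real_inner_comm,
        hin _ _ (by omega : i ≤ i + 1)]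
      ring
    rw [h, inner_zero_left] at h2
    have := hval (Nat.lt_succ_self i)
    simp only [Nat.succ_eq_add_one] at this
    linarith
  have hli : LinearIndependent ℝ d := by
    refine linearIndependent_of_ne_zero_of_inner_eq_zero hne fun i j hij => ?_
    rcases lt_or_gt_of_ne hij with h | h
    · exact horth i j h
    · rw [real_inner_comm]; exact horth j i h
  have := hli.finite
  exact not_finite ℕ

end TailIndicator

section MixedProblem

variable {μ : Measure ℝ}

theorem IsNonatomicProb.memLp (hμ : IsNonatomicProb μ) {f : ℝ → ℝ} (hf : Continuous f) :
    MemLp f 2 μ := by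
  have := hμ.prob
  obtain ⟨C, hC⟩ := isCompact_Icc.exists_bound_of_continuousOn (hf.continuousOn (s := Icc 0 1))
  exact MemLp.of_bound hf.aestronglyMeasurable C (hμ.ae_mem.mono fun x hx => hC x hx)

/-- An eigenvector of the Green operator of the mixed problem `u 0 = 0`, `u' 1 = 0` is a solution
of the Krein-Feller equation. -/
theorem IsNonatomicProb.exists_isSol_of_eigenvector (hμ : IsNonatomicProb μ) [IsFiniteMeasure μ]
    {k : ℝ} (hk : k ≠ 0) {f : Lp ℝ 2 μ} (hf : curveOp (tailInd μ) f = k • f) :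
    ∃ u v, IsSol μ k⁻¹ u v ∧ u 0 = 0 ∧ v 1 = 0 ∧ f =ᵐ[μ] u := by
  have hint : ∀ g : Lp ℝ 2 μ, Integrable g μ := fun g => (Lp.memLp g).integrable one_le_two
  set w : ℝ → ℝ := fun t => inner ℝ (tailInd μ t) f with hw
  have hwc : Continuous w := hμ.continuous_tailInd.inner continuous_const
  have hwe : ∀ (g : Lp ℝ 2 μ) t, inner ℝ (tailInd μ t) g =
      (∫ x in (0 : ℝ)..1, g x ∂μ) - ∫ x in (0 : ℝ)..t, g x ∂μ := fun g t => by
    rw [inner_tailInd, hμ.setIntegral_Ioi (hint g)]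
  set u : ℝ → ℝ := fun x => ∫ t in (0 : ℝ)..x, k⁻¹ * w t with hu
  have hvc : Continuous fun t => k⁻¹ * w t := hwc.const_mul _
  have hud : ∀ x, HasDerivAt u (k⁻¹ * w x) x := fun x =>
    intervalIntegral.integral_hasDerivAt_right (hvc.intervalIntegrable _ _)
      (hvc.stronglyMeasurableAtFilter _ _) hvc.continuousAt
  have huc : Continuous u := continuous_iff_continuousAt.2 fun x => (hud x).continuousAt
  have hmem := hμ.memLp huc
  -- The eigenvector is recovered weakly: paired with any g, the eigenvalue equation gives k⁻¹ ∫
  -- w(t) ⟨e(t), g⟩ dt, which equals ∫ u g dμ by integration by parts.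
  have hfu : f = hmem.toLp u := by
    refine ext_inner_left ℝ fun g => ?_
    have e1 : inner ℝ g f = k⁻¹ * ∫ t in (0 : ℝ)..1, w t * inner ℝ (tailInd μ t) g := by
      rw [← inner_curveOp hμ.continuous_tailInd, hf, inner_smul_right, inv_mul_cancel_left₀ hk]
    have e2 : inner ℝ g (hmem.toLp u) = ∫ x in (0 : ℝ)..1, u x * g x ∂μ := by
      rw [L2.inner_def, ← hμ.integral_eq]
      refine integral_congr_ae ?_
      filter_upwards [hmem.coeFn_toLp] with x hx
      rw [hx]; simp
    have hgc : Continuous fun t => ∫ x in (0 : ℝ)..t, g x ∂μ := by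
      have := hμ.nullSingletonClass
      exact (hint g).continuous_primitive 0
    rw [e1, e2, integral_mul_eq_sub_primitive hud hvc (hint g) zero_le_one]
    have e3 : u 1 = ∫ t in (0 : ℝ)..1, k⁻¹ * w t := rfl
    rw [e3, ← intervalIntegral.integral_mul_const, ← intervalIntegral.integral_sub
      (Continuous.intervalIntegrable (by fun_prop) _ _)
      (Continuous.intervalIntegrable (by fun_prop) _ _), ← intervalIntegral.integral_const_mul]
    refine intervalIntegral.integral_congr fun t _ => ?_
    simp only [hwe g]
    ring
  have hae : f =ᵐ[μ] u := by
    have := hmem.coeFn_toLp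
    rwa [← hfu] at this
  refine ⟨u, fun t => k⁻¹ * w t, ⟨hud, hvc, fun x hx => ?_⟩, by simp [hu], ?_, hae⟩
  · have e : ∫ t in (0 : ℝ)..x, u t ∂μ = ∫ t in (0 : ℝ)..x, f t ∂μ :=
      intervalIntegral.integral_congr_ae (hae.mono fun t h _ => h.symm)
    simp only [hw, hwe f, e, intervalIntegral.integral_same]
    ring
  · simp only [hw, hwe f, sub_self, mul_zero]

/-- The mixed problem `u 0 = 0`, `u' 1 = 0` has infinitely many eigenvalues. -/
theorem IsNonatomicProb.infinite_mixed_zeros (hμ : IsNonatomicProb μ) :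
    {l | fundDeriv μ 0 1 l 1 = 0}.Infinite := by
  have := hμ.prob
  intro hfin
  have hs : ∀ l, MemLp (fund μ 0 1 l) 2 μ := fun l => hμ.memLp (hμ.isSol_fund 0 1 l).continuous
  -- An eigenvector for k ≠ 0 is a solution vanishing at 0, hence a multiple of `fund μ 0 1 k⁻¹`; if
  -- the multiple is nonzero, v(1) = 0 makes k⁻¹ a mixed eigenvalue. So all such eigenvectors lie in
  -- `W`.
  set W : Submodule ℝ (Lp ℝ 2 μ) :=
    Submodule.span ℝ ((fun l => (hs l).toLp _) '' {l | fundDeriv μ 0 1 l 1 = 0}) with hW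
  have hWfd : FiniteDimensional ℝ W := FiniteDimensional.span_of_finite ℝ (hfin.image _)
  obtain ⟨V, hV, hVmem⟩ := exists_finiteDimensional_curve hμ.continuous_tailInd W
    (fun k f hk hf => by
      obtain ⟨u, v, hsol, hu0, hv1, hae⟩ := hμ.exists_isSol_of_eigenvector hk hf
      have heq := ((hμ.isSol_fund 0 1 k⁻¹).smul (v 0)).eq_of_initial hμ hsol
        (by simp [hu0]) (by simp)
      have hfe : f = v 0 • (hs k⁻¹).toLp _ := by
        refine Lp.ext ?_
        filter_upwards [hae, Lp.coeFn_smul (v 0) ((hs k⁻¹).toLp _), (hs k⁻¹).coeFn_toLp, hμ.ae_mem]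
          with x h1 h2 h3 h4
        rw [h1, h2, Pi.smul_apply, h3, (heq x h4).1, smul_eq_mul]
      rw [hfe]
      by_cases hv0 : v 0 = 0
      · rw [hv0, zero_smul]; exact W.zero_mem
      · refine W.smul_mem _ (Submodule.subset_span ⟨k⁻¹, ?_, rfl⟩)
        have := (heq 1 (by simp)).2
        rw [hv1, eq_comm, mul_eq_zero] at this
        exact this.resolve_left hv0)
  exact hμ.not_finiteDimensional_tailInd V hVmem

end MixedProblem

end KreinFeller

/-! ### Characteristic functions of the boundary value problems and their stability. -/

namespace KreinFeller

open Topology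

/-- The `L₂(μ)` pairing of the solutions with initial data `(a, b)`. -/
noncomputable def pairing (μ : Measure ℝ) (a b l k : ℝ) : ℝ :=
  ∫ x, fund μ a b l x * fund μ a b k x ∂μ

/-- A Lipschitz constant for the dependence of solutions on all data. -/
noncomputable def lipBound (L : ℝ) : ℝ :=
  2 * solBound L ^ 3 * (1 + 2 * L) + 4 * solBound L ^ 2 + solBound L ^ 2 * (1 + 2 * L)

theorem lipBound_pos {L : ℝ} (hL : 0 < L) : 0 < lipBound L := by
  have := solBound_pos hL
  unfold lipBound; positivity

section Dependence

variable {μ μ' : Measure ℝ} {a b : ℝ}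

theorem abs_fund_sub_le (hμ : IsNonatomicProb μ) (hμ' : IsNonatomicProb μ') (hab : |a| + |b| ≤ 1)
    {L δ l l' : ℝ} (hL : 0 < L) (hl : |l| ≤ L) (hl' : |l'| ≤ L)
    (hδ : ∀ x ∈ Icc (0 : ℝ) 1, |distFun μ' x - distFun μ x| ≤ δ) :
    ∀ x ∈ Icc (0 : ℝ) 1, |fund μ' a b l' x - fund μ a b l x| ≤ lipBound L * (|l' - l| + δ) ∧
      |fundDeriv μ' a b l' x - fundDeriv μ a b l x| ≤ lipBound L * (|l' - l| + δ) := by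
  have hδ0 : 0 ≤ δ := (abs_nonneg _).trans (hδ 0 (by simp))
  have hb := solBound_pos hL
  intro x hx
  have h := IsSol.abs_sub_le hμ hμ' (hμ.isSol_fund a b l) (hμ'.isSol_fund a b l') (by simp)
    (by simp) hL hl hl' (m := 1) (by simpa using hab) hδ x hx
  have hle : solBound L ^ 2 * (1 + 2 * L) * 1 * (|l' - l| + δ) ≤ lipBound L * (|l' - l| + δ) := by
    refine mul_le_mul_of_nonneg_right ?_ (by positivity)
    unfold lipBound
    have : 0 ≤ 2 * solBound L ^ 3 * (1 + 2 * L) + 4 * solBound L ^ 2 := by positivity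
    linarith
  exact ⟨h.1.trans hle, h.2.trans hle⟩

theorem abs_fund_le (hμ : IsNonatomicProb μ) (hab : |a| + |b| ≤ 1) {L l : ℝ} (hL : 0 < L)
    (hl : |l| ≤ L) : ∀ x ∈ Icc (0 : ℝ) 1, |fund μ a b l x| ≤ solBound L := fun x hx => by
  simpa using ((hμ.isSol_fund a b l).abs_le hμ hL hl (m := 1) (by simpa using hab) x hx).1

theorem abs_pairing_sub_le (hμ : IsNonatomicProb μ) (hμ' : IsNonatomicProb μ')
    (hab : |a| + |b| ≤ 1) {L δ l l' k k' : ℝ} (hL : 0 < L) (hl : |l| ≤ L) (hl' : |l'| ≤ L)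
    (hk : |k| ≤ L) (hk' : |k'| ≤ L)
    (hδ : ∀ x ∈ Icc (0 : ℝ) 1, |distFun μ' x - distFun μ x| ≤ δ) :
    |pairing μ' a b l' k' - pairing μ a b l k| ≤ lipBound L * (|l' - l| + |k' - k| + δ) := by
  have hδ0 : 0 ≤ δ := (abs_nonneg _).trans (hδ 0 (by simp))
  have hb := solBound_pos hL
  refine (IsSol.abs_integral_mul_sub_le hμ hμ' (hμ.isSol_fund a b l) (hμ.isSol_fund a b k)
    (hμ'.isSol_fund a b l') (hμ'.isSol_fund a b k') (by simp) (by simp) (by simp) (by simp)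
    (by simpa using hab) (by simpa using hab) hL hl hk hl' hk' hδ).trans ?_
  refine mul_le_mul_of_nonneg_right ?_ (by positivity)
  unfold lipBound
  have : 0 ≤ solBound L ^ 2 * (1 + 2 * L) := by positivity
  linarith

theorem continuous_of_lipschitz_on_bounded {f : ℝ → ℝ}
    (hf : ∀ L > 0, ∀ l l', |l| ≤ L → |l'| ≤ L → |f l' - f l| ≤ lipBound L * |l' - l|) :
    Continuous f := by
  refine continuous_iff_continuousAt.2 fun l => ?_
  rw [ContinuousAt, tendsto_iff_norm_sub_tendsto_zero]
  have hc : Continuous fun l' : ℝ => lipBound (|l| + 1) * |l' - l| := by fun_prop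
  have ht := hc.tendsto l
  rw [sub_self, abs_zero, mul_zero] at ht
  refine squeeze_zero' (Eventually.of_forall fun _ => norm_nonneg _) ?_ ht
  filter_upwards [continuous_abs.continuousAt.eventually_lt continuousAt_const
    (lt_add_one |l|)] with l' hl'
  exact hf _ (by positivity) l l' (by linarith) hl'.le

theorem continuous_pairing (hμ : IsNonatomicProb μ) (hab : |a| + |b| ≤ 1) :
    Continuous fun z : ℝ × ℝ => pairing μ a b z.1 z.2 := by
  refine continuous_iff_continuousAt.2 fun z => ?_
  rw [ContinuousAt, tendsto_iff_norm_sub_tendsto_zero]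
  set L := max |z.1| |z.2| + 1 with hL
  have hc : Continuous fun z' : ℝ × ℝ => lipBound L * (|z'.1 - z.1| + |z'.2 - z.2| + 0) := by
    fun_prop
  have ht := hc.tendsto z
  simp only [sub_self, abs_zero, add_zero, mul_zero] at ht
  have hcm : Continuous fun z' : ℝ × ℝ => max |z'.1| |z'.2| := by fun_prop
  refine squeeze_zero' (Eventually.of_forall fun _ => norm_nonneg _) ?_ ht
  filter_upwards [hcm.continuousAt.eventually_lt continuousAt_const (lt_add_one _)] with z' hz'
  have := abs_pairing_sub_le (a := a) (b := b) hμ hμ hab (L := L) (δ := 0) (l := z.1)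
    (k := z.2) (l' := z'.1) (k' := z'.2) (by positivity)
    ((le_max_left _ _).trans (lt_add_one _).le) ((le_max_left _ _).trans hz'.le)
    ((le_max_right _ _).trans (lt_add_one _).le) ((le_max_right _ _).trans hz'.le) (by simp)
  simpa using this

end Dependence

section CharacteristicFunctions

variable {μ : Measure ℝ} {a b : ℝ}

theorem continuous_fund_one (hμ : IsNonatomicProb μ) (hab : |a| + |b| ≤ 1) :
    Continuous fun l => fund μ a b l 1 :=
  continuous_of_lipschitz_on_bounded fun L hL l l' hl hl' => by
    simpa using (abs_fund_sub_le hμ hμ hab hL hl hl' (δ := 0) (by simp) 1 (by simp)).1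

theorem continuous_fundDeriv_one (hμ : IsNonatomicProb μ) (hab : |a| + |b| ≤ 1) :
    Continuous fun l => fundDeriv μ a b l 1 :=
  continuous_of_lipschitz_on_bounded fun L hL l l' hl hl' => by
    simpa using (abs_fund_sub_le hμ hμ hab hL hl hl' (δ := 0) (by simp) 1 (by simp)).2

theorem fund_lagrange (hμ : IsNonatomicProb μ) (l k : ℝ) :
    fundDeriv μ a b l 1 * fund μ a b k 1 - fund μ a b l 1 * fundDeriv μ a b k 1 =
      (k - l) * pairing μ a b l k := by
  have := (hμ.isSol_fund a b l).lagrange hμ (hμ.isSol_fund a b k)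
  simp only [fund_zero, fundDeriv_zero] at this
  rw [pairing, ← this]; ring

theorem pairing_pos (hμ : IsNonatomicProb μ) (hne : a ≠ 0 ∨ b ≠ 0) (l : ℝ) :
    0 < pairing μ a b l l :=
  (hμ.isSol_fund a b l).integral_sq_pos hμ (by simpa using hne)

/-- The Lagrange form is antisymmetric in u(1) and u'(1), so taking u'(1) as χ makes -u(1) the
complement. -/
theorem charData_deriv (hμ : IsNonatomicProb μ) (hab : |a| + |b| ≤ 1) (hne : a ≠ 0 ∨ b ≠ 0) :
    CharData (fun l => fundDeriv μ a b l 1) (fun l => -fund μ a b l 1) (pairing μ a b) where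
  continuous := continuous_fundDeriv_one hμ hab
  continuous_pairing := continuous_pairing hμ hab
  pos := pairing_pos hμ hne
  lagrange l k := by rw [← fund_lagrange hμ l k]; ring

theorem charData_value (hμ : IsNonatomicProb μ) (hab : |a| + |b| ≤ 1) (hne : a ≠ 0 ∨ b ≠ 0) :
    CharData (fun l => fund μ a b l 1) (fun l => fundDeriv μ a b l 1) (pairing μ a b) where
  continuous := continuous_fund_one hμ hab
  continuous_pairing := continuous_pairing hμ hab
  pos := pairing_pos hμ hne
  lagrange l k := fund_lagrange hμ l k

theorem nonneg_of_fundDeriv_eq_zero (hμ : IsNonatomicProb μ) (hne : a ≠ 0 ∨ b ≠ 0)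
    (hab : a * b = 0) {l : ℝ} (h : fundDeriv μ a b l 1 = 0) : 0 ≤ l :=
  (hμ.isSol_fund a b l).eigenvalue_nonneg hμ (by simpa using hne) (by simpa using hab)
    (by rw [h, mul_zero])

theorem nonneg_of_fund_eq_zero (hμ : IsNonatomicProb μ) (hne : a ≠ 0 ∨ b ≠ 0)
    (hab : a * b = 0) {l : ℝ} (h : fund μ a b l 1 = 0) : 0 ≤ l :=
  (hμ.isSol_fund a b l).eigenvalue_nonneg hμ (by simpa using hne) (by simpa using hab)
    (by rw [h, zero_mul])

/-- The Lagrange identity for two solutions with the same parameter: the boundary form at 1 equals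
that at 0. -/
theorem wronskian (hμ : IsNonatomicProb μ) (l : ℝ) :
    fund μ 1 0 l 1 * fundDeriv μ 0 1 l 1 - fundDeriv μ 1 0 l 1 * fund μ 0 1 l 1 = 1 := by
  have := (hμ.isSol_fund 1 0 l).lagrange hμ (hμ.isSol_fund 0 1 l)
  simp only [fund_zero, fundDeriv_zero, sub_self, zero_mul] at this
  linarith

/-- Interlacing with the mixed problem u(0) = u'(1) = 0; the complement itself serves as Z, so the
sign condition is that a square is positive. -/
theorem infinite_dirichlet_zeros (hμ : IsNonatomicProb μ) : {l | fund μ 0 1 l 1 = 0}.Infinite := by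
  have hc := charData_deriv (a := 0) (b := 1) hμ (by simp) (by simp)
  have := hc.infinite_zeros_of_interlacing
    (fun l => nonneg_of_fundDeriv_eq_zero hμ (by simp) (by simp)) hμ.infinite_mixed_zeros
    (Z := fun l => -fund μ 0 1 l 1) (continuous_fund_one hμ (by simp)).neg
    (fun l hl => mul_self_pos.2 (hc.complement_ne_zero hl))
  simpa using this

/-- Two interlacings: from Dirichlet to the mixed problem u'(0) = u(1) = 0, where the Wronskian
supplies the sign, and from there to Neumann. -/
theorem infinite_neumann_zeros (hμ : IsNonatomicProb μ) :
    {l | fundDeriv μ 1 0 l 1 = 0}.Infinite := by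
  have h1 : {l | fund μ 1 0 l 1 = 0}.Infinite :=
    (charData_value (a := 0) (b := 1) hμ (by simp) (by simp)).infinite_zeros_of_interlacing
      (fun l => nonneg_of_fund_eq_zero hμ (by simp) (by simp)) (infinite_dirichlet_zeros hμ)
      (continuous_fund_one hμ (by simp)) (fun l hl => by
        have := wronskian hμ l
        rw [hl, mul_zero, sub_zero] at this
        rw [this]; exact one_pos)
  have hc := charData_value (a := 1) (b := 0) hμ (by simp) (by simp)
  exact hc.infinite_zeros_of_interlacing
    (fun l => nonneg_of_fund_eq_zero hμ (by simp) (by simp)) h1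
    (continuous_fundDeriv_one hμ (by simp))
    (fun l hl => mul_self_pos.2 (hc.complement_ne_zero hl))

/-- A characteristic function, given for all nonatomic probability measures at once, of an
eigenvalue problem whose eigenfunctions have initial data `(a, b)`. -/
structure IsCharFun (a b : ℝ) (X : Measure ℝ → ℝ → ℝ) : Prop where
  abs_add_abs_le : |a| + |b| ≤ 1
  charData : ∀ μ, IsNonatomicProb μ → ∃ A, CharData (X μ) A (pairing μ a b)
  nonneg : ∀ μ, IsNonatomicProb μ → ∀ l, X μ l = 0 → 0 ≤ l
  infinite : ∀ μ, IsNonatomicProb μ → {l | X μ l = 0}.Infinite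
  lipschitz : ∀ μ μ', IsNonatomicProb μ → IsNonatomicProb μ' → ∀ L > 0, ∀ δ,
    (∀ x ∈ Icc (0 : ℝ) 1, |distFun μ' x - distFun μ x| ≤ δ) →
    ∀ l, |l| ≤ L → |X μ' l - X μ l| ≤ lipBound L * δ

theorem isCharFun_neumann : IsCharFun 1 0 fun μ l => fundDeriv μ 1 0 l 1 where
  abs_add_abs_le := by simp
  charData _ hμ := ⟨_, charData_deriv hμ (by simp) (by simp)⟩
  nonneg _ hμ _ := nonneg_of_fundDeriv_eq_zero hμ (by simp) (by simp)
  infinite _ hμ := infinite_neumann_zeros hμ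
  lipschitz _ _ hμ hμ' L hL δ hδ l hl := by
    simpa using (abs_fund_sub_le hμ hμ' (by simp) hL hl hl hδ 1 (by simp)).2

theorem isCharFun_dirichlet : IsCharFun 0 1 fun μ l => fund μ 0 1 l 1 where
  abs_add_abs_le := by simp
  charData _ hμ := ⟨_, charData_value hμ (by simp) (by simp)⟩
  nonneg _ hμ _ := nonneg_of_fund_eq_zero hμ (by simp) (by simp)
  infinite _ hμ := infinite_dirichlet_zeros hμ
  lipschitz _ _ hμ hμ' L hL δ hδ l hl := by
    simpa using (abs_fund_sub_le hμ hμ' (by simp) hL hl hl hδ 1 (by simp)).1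

namespace IsCharFun

variable {X : Measure ℝ → ℝ → ℝ}

theorem finite_Iic (h : IsCharFun a b X) (hμ : IsNonatomicProb μ) (R : ℝ) :
    ({l | X μ l = 0} ∩ Iic R).Finite := by
  obtain ⟨A, hA⟩ := h.charData μ hμ
  exact hA.finite_zeros_Iic (h.nonneg μ hμ) R

theorem nthSmallest_mem (h : IsCharFun a b X) (hμ : IsNonatomicProb μ) (m : ℕ) :
    X μ (nthSmallest {l | X μ l = 0} m) = 0 :=
  KreinFeller.nthSmallest_mem (h.infinite μ hμ) (h.finite_Iic hμ) m

/-- Eigenvalues and normalized eigenfunctions are Lipschitz in the distribution function. -/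
theorem eigen_lipschitz (h : IsCharFun a b X) (hμ : IsNonatomicProb μ) (m : ℕ) :
    ∃ c > 0, ∃ d₀ > 0, ∀ μ', IsNonatomicProb μ' → ∀ δ ≤ d₀,
      (∀ x ∈ Icc (0 : ℝ) 1, |distFun μ' x - distFun μ x| ≤ δ) →
      |nthSmallest {l | X μ' l = 0} m - nthSmallest {l | X μ l = 0} m| ≤ c * δ ∧
      ∀ x ∈ Icc (0 : ℝ) 1, |fund μ' a b (nthSmallest {l | X μ' l = 0} m) x| ≤ c ∧
        |fund μ' a b (nthSmallest {l | X μ' l = 0} m) x -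
          fund μ a b (nthSmallest {l | X μ l = 0} m) x| ≤ c * δ := by
  obtain ⟨A, hA⟩ := h.charData μ hμ
  set y := nthSmallest {l | X μ l = 0} m with hy
  have hy0 : 0 ≤ y := h.nonneg μ hμ y (h.nthSmallest_mem hμ m)
  set R := y + 1 with hR
  have hR0 : 0 < R := by positivity
  obtain ⟨c₁, hc₁, d₁, hd₁, H⟩ := hA.nthSmallest_lipschitz (h.nonneg μ hμ) (h.infinite μ hμ)
    (R := R) m le_rfl
  have hC := lipBound_pos hR0
  set C := lipBound R with hCdef
  have hS := solBound_pos hR0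
  -- The summands bound the shift of the eigenvalue, the size of the perturbed eigenfunction and the
  -- shift of the eigenfunction. The radius d₁ / C makes the perturbation C δ of χ and J admissible.
  refine ⟨c₁ * C + solBound R + C * (c₁ * C + 1), by positivity, d₁ / C, by positivity,
    fun μ' hμ' δ hδ hclose => ?_⟩
  have hδ0 : 0 ≤ δ := (abs_nonneg _).trans (hclose 0 (by simp))
  obtain ⟨A', hA'⟩ := h.charData μ' hμ'
  set y' := nthSmallest {l | X μ' l = 0} m with hy'
  have hy'0 : 0 ≤ y' := h.nonneg μ' hμ' y' (h.nthSmallest_mem hμ' m)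
  obtain ⟨h1, h2⟩ := H (X μ') A' (pairing μ' a b) hA' (h.nonneg μ' hμ') (h.infinite μ' hμ')
    (C * δ) (by rw [le_div_iff₀ hC] at hδ; linarith)
    ⟨h.lipschitz μ μ' hμ hμ' R hR0 δ hclose, fun l k hl hk => by
      simpa using abs_pairing_sub_le hμ hμ' h.abs_add_abs_le hR0 hl hl hk hk hclose⟩
  have hy'R : |y'| ≤ R := by rwa [abs_of_nonneg hy'0]
  have hyR : |y| ≤ R := by rw [abs_of_nonneg hy0]; linarith
  refine ⟨h2.trans ?_, fun x hx => ⟨(abs_fund_le hμ' h.abs_add_abs_le hR0 hy'R x hx).trans ?_, ?_⟩⟩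
  · rw [← mul_assoc]
    have : 0 ≤ solBound R + C * (c₁ * C + 1) := by positivity
    gcongr
    linarith
  · have : 0 ≤ c₁ * C + C * (c₁ * C + 1) := by positivity
    linarith
  · refine ((abs_fund_sub_le hμ hμ' h.abs_add_abs_le hR0 hyR hy'R hclose x hx).1).trans ?_
    calc C * (|y' - y| + δ) ≤ C * (c₁ * (C * δ) + δ) := by gcongr
      _ = C * (c₁ * C + 1) * δ := by ring
      _ ≤ _ := by
        have : 0 ≤ c₁ * C + solBound R := by positivity
        gcongr
        linarith

end IsCharFun

end CharacteristicFunctions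

/-! ### Identification of spectra and eigenfunctions, and the Lipschitz estimates. -/

section Eigenfunctions

variable {μ : Measure ℝ} {l : ℝ} {f : ℝ → ℝ}

/-- The derivative on [0,1] is extended by clamping and integrated back. The almost-everywhere
equation suffices since it enters only under an integral, and nontriviality passes to the initial
data by uniqueness. -/
theorem SolvesEigen.exists_isSol (hμ : IsNonatomicProb μ) (h : SolvesEigen μ l f) :
    ∃ u v, IsSol μ l u v ∧ (∀ x ∈ Icc (0 : ℝ) 1, u x = f x ∧ v x = deriv01 f x) ∧
      (u 0 ≠ 0 ∨ v 0 ≠ 0) := by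
  obtain ⟨⟨g, ⟨hf, hg, hfg⟩, hgf⟩, x₀, hx₀, hne⟩ := h
  have hvc : Continuous fun x => deriv01 f (clamp x) :=
    (hf.continuousOn_derivWithin (uniqueDiffOn_Icc zero_lt_one) le_rfl).comp_continuous
      continuous_clamp clamp_mem
  set v : ℝ → ℝ := fun x => deriv01 f (clamp x) with hv
  set u : ℝ → ℝ := fun x => f 0 + ∫ t in (0 : ℝ)..x, v t with hu
  have hvf : ∀ x ∈ Icc (0 : ℝ) 1, v x = deriv01 f x := fun x hx => by simp only [hv, clamp_eq hx]
  have huf : ∀ x ∈ Icc (0 : ℝ) 1, u x = f x := by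
    intro x hx
    have := intervalIntegral.integral_eq_sub_of_hasDerivAt_of_le hx.1
      (hf.continuousOn.mono (Icc_subset_Icc_right hx.2)) (f' := v) (fun t ht => by
        have ht' : t ∈ Ioo (0 : ℝ) 1 := ⟨ht.1, ht.2.trans_le hx.2⟩
        rw [hvf t (Ioo_subset_Icc_self ht')]
        exact ((hf.differentiableOn one_ne_zero t (Ioo_subset_Icc_self ht')).hasDerivWithinAt).hasDerivAt
          (Icc_mem_nhds ht'.1 ht'.2)) (hvc.intervalIntegrable _ _)
    simp only [hu, this]; ring
  have hsol : IsSol μ l u v := by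
    refine ⟨fun x => (intervalIntegral.integral_hasDerivAt_right (hvc.intervalIntegrable _ _)
      (hvc.stronglyMeasurableAtFilter _ _) hvc.continuousAt).const_add _, hvc, fun x hx => ?_⟩
    rw [hvf x hx, hvf 0 (by simp), hfg x hx, sub_eq_add_neg, ← neg_mul,
      ← intervalIntegral.integral_const_mul]
    congr 1
    refine intervalIntegral.integral_congr_ae ?_
    filter_upwards [hgf, hμ.ae_mem] with t ht ht' _
    rw [ht, huf t ht']
  refine ⟨u, v, hsol, fun x hx => ⟨huf x hx, hvf x hx⟩, ?_⟩
  by_contra! hz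
  have := ((hsol.smul 0).eq_of_initial hμ hsol (by simp [hz.1]) (by simp [hz.2]) x₀ hx₀).1
  rw [huf x₀ hx₀, zero_mul] at this
  exact hne this

theorem IsSol.solvesEigen (hμ : IsNonatomicProb μ) {u v : ℝ → ℝ} (h : IsSol μ l u v)
    (hfu : ∀ x ∈ Icc (0 : ℝ) 1, f x = u x) (hne : ∃ x ∈ Icc (0 : ℝ) 1, u x ≠ 0) :
    SolvesEigen μ l f ∧ ∀ x ∈ Icc (0 : ℝ) 1, deriv01 f x = v x := by
  have hd : ∀ x ∈ Icc (0 : ℝ) 1, deriv01 f x = v x := by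
    intro x hx
    rw [deriv01, derivWithin_congr hfu (hfu x hx)]
    exact (h.hasDerivAt x).hasDerivWithinAt.derivWithin (uniqueDiffOn_Icc zero_lt_one x hx)
  have hC1 : ContDiff ℝ 1 u := by
    rw [contDiff_one_iff_deriv]
    refine ⟨fun x => (h.hasDerivAt x).differentiableAt, ?_⟩
    rw [funext fun x => (h.hasDerivAt x).deriv]
    exact h.continuous_deriv
  refine ⟨⟨⟨fun x => -l * u x, ⟨hC1.contDiffOn.congr hfu, hμ.memLp (h.continuous.const_mul _),
    fun x hx => ?_⟩, hμ.ae_mem.mono fun x hx => ?_⟩, ?_⟩, hd⟩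
  · rw [hd x hx, hd 0 (by simp), h.deriv_eq x hx, intervalIntegral.integral_const_mul]; ring
  · simp only [hfu x hx]
  · obtain ⟨x, hx, hx'⟩ := hne
    exact ⟨x, hx, by rwa [hfu x hx]⟩

theorem isNeumannEigenfunction_of (hμ : IsNonatomicProb μ) {c : ℝ} (hc : c ≠ 0)
    (hl : fundDeriv μ 1 0 l 1 = 0) (hf : ∀ x ∈ Icc (0 : ℝ) 1, f x = c * fund μ 1 0 l x) :
    IsNeumannEigenfunction μ l f := by
  obtain ⟨h1, h2⟩ := ((hμ.isSol_fund 1 0 l).smul c).solvesEigen hμ hf ⟨0, by simp, by simpa⟩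
  exact ⟨h1, by rw [h2 0 (by simp)]; simp, by rw [h2 1 (by simp), hl, mul_zero]⟩

theorem isDirichletEigenfunction_of (hμ : IsNonatomicProb μ) {c : ℝ} (hc : c ≠ 0)
    (hl : fund μ 0 1 l 1 = 0) (hf : ∀ x ∈ Icc (0 : ℝ) 1, f x = c * fund μ 0 1 l x) :
    IsDirichletEigenfunction μ l f := by
  have hsol := (hμ.isSol_fund 0 1 l).smul c
  have hne : ∃ x ∈ Icc (0 : ℝ) 1, c * fund μ 0 1 l x ≠ 0 := by
    by_contra! hz
    have hp := hsol.integral_sq_pos hμ (by simpa using hc)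
    rw [integral_congr_ae (g := fun _ => 0), integral_zero] at hp
    · exact lt_irrefl _ hp
    · exact hμ.ae_mem.mono fun x hx => by simp [hz x hx]
  obtain ⟨h1, -⟩ := hsol.solvesEigen hμ hf hne
  exact ⟨h1, by rw [hf 0 (by simp)]; simp, by rw [hf 1 (by simp), hl, mul_zero]⟩

/-- The condition at 0 makes an eigenfunction a nonzero multiple of `fund μ 1 0 l`, so the condition
at 1 becomes a condition on l alone. -/
theorem neumannSpectrum_eq (hμ : IsNonatomicProb μ) :
    neumannSpectrum μ = {l | fundDeriv μ 1 0 l 1 = 0} := by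
  ext l
  constructor
  · rintro ⟨f, hf, hf0, hf1⟩
    obtain ⟨u, v, hsol, huv, hne⟩ := hf.exists_isSol hμ
    have hv0 : v 0 = 0 := by rw [(huv 0 (by simp)).2, hf0]
    have hv1 : v 1 = 0 := by rw [(huv 1 (by simp)).2, hf1]
    have := (((hμ.isSol_fund 1 0 l).smul (u 0)).eq_of_initial hμ hsol (by simp) (by simp [hv0])
      1 (by simp)).2
    rw [hv1, eq_comm, mul_eq_zero] at this
    exact this.resolve_left (hne.resolve_right (not_not.2 hv0))
  · intro hl
    exact ⟨_, isNeumannEigenfunction_of hμ one_ne_zero hl (fun x _ => (one_mul _).symm)⟩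

theorem dirichletSpectrum_eq (hμ : IsNonatomicProb μ) :
    dirichletSpectrum μ = {l | fund μ 0 1 l 1 = 0} := by
  ext l
  constructor
  · rintro ⟨f, hf, hf0, hf1⟩
    obtain ⟨u, v, hsol, huv, hne⟩ := hf.exists_isSol hμ
    have hu0 : u 0 = 0 := by rw [(huv 0 (by simp)).1, hf0]
    have hu1 : u 1 = 0 := by rw [(huv 1 (by simp)).1, hf1]
    have := (((hμ.isSol_fund 0 1 l).smul (v 0)).eq_of_initial hμ hsol (by simp [hu0]) (by simp)
      1 (by simp)).1
    rw [hu1, eq_comm, mul_eq_zero] at this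
    exact this.resolve_left (hne.resolve_left (not_not.2 hu0))
  · intro hl
    exact ⟨_, isDirichletEigenfunction_of hμ one_ne_zero hl (fun x _ => (one_mul _).symm)⟩

theorem neumannEigenvalue_eq (hμ : IsNonatomicProb μ) (m : ℕ) :
    neumannEigenvalue μ m = nthSmallest {l | fundDeriv μ 1 0 l 1 = 0} m := by
  rw [neumannEigenvalue, neumannSpectrum_eq hμ]

theorem dirichletEigenvalue_eq (hμ : IsNonatomicProb μ) (m : ℕ) :
    dirichletEigenvalue μ m = nthSmallest {l | fund μ 0 1 l 1 = 0} (m - 1) := by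
  rw [dirichletEigenvalue, dirichletSpectrum_eq hμ]

theorem neumannEigenvalue_nonneg (hμ : IsNonatomicProb μ) (m : ℕ) : 0 ≤ neumannEigenvalue μ m := by
  rw [neumannEigenvalue_eq hμ]
  exact isCharFun_neumann.nonneg μ hμ _ (isCharFun_neumann.nthSmallest_mem hμ m)

/-- For l = 0 the solution with data (0, 1) is x, which does not vanish at 1. Positivity is needed
to divide by √λ. -/
theorem dirichletEigenvalue_pos (hμ : IsNonatomicProb μ) (m : ℕ) :
    0 < dirichletEigenvalue μ m := by
  rw [dirichletEigenvalue_eq hμ]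
  have h0 := isCharFun_dirichlet.nthSmallest_mem hμ (m - 1)
  refine lt_of_le_of_ne (isCharFun_dirichlet.nonneg μ hμ _ h0) fun h => ?_
  rw [← h] at h0
  simp [fund, fundDeriv] at h0

theorem neumannEigenfunction_eq (hμ : IsNonatomicProb μ) (m : ℕ) {x : ℝ}
    (hx : x ∈ Icc (0 : ℝ) 1) :
    neumannEigenfunction μ m x = fund μ 1 0 (neumannEigenvalue μ m) x :=
  hμ.cp_eq_fund (neumannEigenvalue_nonneg hμ m) hx

theorem dirichletEigenfunction_eq (hμ : IsNonatomicProb μ) (m : ℕ) {x : ℝ}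
    (hx : x ∈ Icc (0 : ℝ) 1) :
    dirichletEigenfunction μ m x =
      √(dirichletEigenvalue μ m) * fund μ 0 1 (dirichletEigenvalue μ m) x :=
  hμ.sq_eq_fund (dirichletEigenvalue_pos hμ m).le hx

theorem neumannEigenfunction_lipschitz (hμ : IsNonatomicProb μ) (m : ℕ) :
    ∃ c > 0, ∃ d₀ > 0, ∀ μ', IsNonatomicProb μ' → ∀ δ ≤ d₀,
      (∀ x ∈ Icc (0 : ℝ) 1, |distFun μ' x - distFun μ x| ≤ δ) →
      ∀ x ∈ Icc (0 : ℝ) 1, |neumannEigenfunction μ' m x - neumannEigenfunction μ m x| ≤ c * δ := by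
  obtain ⟨c, hc, d₀, hd₀, H⟩ := isCharFun_neumann.eigen_lipschitz hμ m
  refine ⟨c, hc, d₀, hd₀, fun μ' hμ' δ hδ hclose x hx => ?_⟩
  rw [neumannEigenfunction_eq hμ m hx, neumannEigenfunction_eq hμ' m hx, neumannEigenvalue_eq hμ,
    neumannEigenvalue_eq hμ']
  exact ((H μ' hμ' δ hδ hclose).2 x hx).2

/-- The eigenfunction is √λ times `fund`, so a product estimate is needed. The square root is
Lipschitz at y > 0, as |√y' - √y| √y ≤ |y' - y|; the uniform bound on the perturbed `fund` in
`eigen_lipschitz` controls the other factor. -/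
theorem dirichletEigenfunction_lipschitz (hμ : IsNonatomicProb μ) (m : ℕ) :
    ∃ c > 0, ∃ d₀ > 0, ∀ μ', IsNonatomicProb μ' → ∀ δ ≤ d₀,
      (∀ x ∈ Icc (0 : ℝ) 1, |distFun μ' x - distFun μ x| ≤ δ) →
      ∀ x ∈ Icc (0 : ℝ) 1,
        |dirichletEigenfunction μ' m x - dirichletEigenfunction μ m x| ≤ c * δ := by
  obtain ⟨c, hc, d₀, hd₀, H⟩ := isCharFun_dirichlet.eigen_lipschitz hμ (m - 1)
  have hpos := dirichletEigenvalue_pos hμ m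
  set y := dirichletEigenvalue μ m with hy
  have hsq : 0 < √y := Real.sqrt_pos.2 hpos
  refine ⟨c / √y * c + √y * c, by positivity, d₀, hd₀, fun μ' hμ' δ hδ hclose x hx => ?_⟩
  have hδ0 : 0 ≤ δ := (abs_nonneg _).trans (hclose 0 (by simp))
  rw [dirichletEigenfunction_eq hμ m hx, dirichletEigenfunction_eq hμ' m hx]
  obtain ⟨h1, h2⟩ := H μ' hμ' δ hδ hclose
  rw [← dirichletEigenvalue_eq hμ, ← dirichletEigenvalue_eq hμ', ← hy] at h1 h2
  have hpos' := dirichletEigenvalue_pos hμ' m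
  set y' := dirichletEigenvalue μ' m with hy'
  have hs : |√y' - √y| ≤ c / √y * δ := by
    rw [div_mul_eq_mul_div, le_div_iff₀ hsq]
    refine le_trans ?_ h1
    have e : y' - y = (√y' - √y) * (√y' + √y) := by
      linear_combination Real.sq_sqrt hpos.le - Real.sq_sqrt hpos'.le
    rw [e, abs_mul, abs_of_nonneg (by positivity : 0 ≤ √y' + √y)]
    gcongr
    linarith [Real.sqrt_nonneg y']
  have e : √y' * fund μ' 0 1 y' x - √y * fund μ 0 1 y x =
      (√y' - √y) * fund μ' 0 1 y' x + √y * (fund μ' 0 1 y' x - fund μ 0 1 y x) := by ring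
  rw [e]
  refine (abs_add_le _ _).trans ?_
  rw [abs_mul, abs_mul, abs_of_pos hsq]
  have b1 := mul_le_mul hs (h2 x hx).1 (abs_nonneg _) (by positivity)
  have b2 := mul_le_mul_of_nonneg_left (h2 x hx).2 hsq.le
  linarith

end Eigenfunctions

theorem convergence_of_lipschitz {μ : Measure ℝ} {μs : ℕ → Measure ℝ} {f : ℝ → ℝ}
    {fs : ℕ → ℝ → ℝ} {c d₀ : ℝ} (hc : 0 < c) (hd₀ : 0 < d₀)
    (hF : TendstoUniformlyOn (fun n => distFun (μs n)) (distFun μ) atTop (Icc 0 1))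
    (hlip : ∀ n, ∀ δ ≤ d₀, (∀ x ∈ Icc (0 : ℝ) 1, |distFun (μs n) x - distFun μ x| ≤ δ) →
      ∀ x ∈ Icc (0 : ℝ) 1, |fs n x - f x| ≤ c * δ) :
    TendstoUniformlyOn fs f atTop (Icc 0 1) ∧
      ∃ n₀ : ℕ, ∀ n ≥ n₀,
        supDist f (fs n) ≤ (c.toNNReal : ℝ≥0) * supDist (distFun μ) (distFun (μs n)) := by
  rw [Metric.tendstoUniformlyOn_iff] at hF
  constructor
  · rw [Metric.tendstoUniformlyOn_iff]
    intro ε hε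
    filter_upwards [hF (min d₀ (ε / (2 * c))) (lt_min hd₀ (by positivity))] with n hn x hx
    have := hlip n _ (min_le_left _ _) (fun x hx => by
      rw [← Real.dist_eq, dist_comm]; exact (hn x hx).le) x hx
    rw [dist_comm, Real.dist_eq]
    refine this.trans_lt ?_
    calc c * min d₀ (ε / (2 * c)) ≤ c * (ε / (2 * c)) := by gcongr; exact min_le_right _ _
      _ = ε / 2 := by field_simp
      _ < ε := half_lt_self hε
  · obtain ⟨n₀, hn₀⟩ := eventually_atTop.1 (hF d₀ hd₀)
    refine ⟨n₀, fun n hn => ?_⟩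
    -- The optimal δ is the sup distance itself; it is first shown to be at most d₀, hence finite,
    -- so that it may be used as a real number.
    set D := supDist (distFun μ) (distFun (μs n)) with hD
    have hDle : D ≤ ENNReal.ofReal d₀ := iSup₂_le fun x hx =>
      ENNReal.ofReal_le_ofReal (by rw [← Real.dist_eq]; exact (hn₀ n hn x hx).le)
    have hDtop : D ≠ ⊤ := ne_top_of_le_ne_top ENNReal.ofReal_ne_top hDle
    have hpt : ∀ x ∈ Icc (0 : ℝ) 1, |distFun (μs n) x - distFun μ x| ≤ D.toReal := by
      intro x hx
      rw [abs_sub_comm, ← ENNReal.ofReal_le_iff_le_toReal hDtop]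
      exact le_iSup₂ (f := fun x (_ : x ∈ Icc (0 : ℝ) 1) =>
        ENNReal.ofReal |distFun μ x - distFun (μs n) x|) x hx
    have hb := hlip n D.toReal (ENNReal.toReal_le_of_le_ofReal hd₀.le hDle) hpt
    refine iSup₂_le fun x hx => ?_
    rw [abs_sub_comm]
    refine (ENNReal.ofReal_le_ofReal (hb x hx)).trans (le_of_eq ?_)
    rw [ENNReal.ofReal_mul hc.le, ENNReal.ofReal_toReal hDtop]
    rfl

end KreinFeller

/-! ### Assembly of the theorem. -/

theorem theorem3p8 (μ : Measure ℝ) (hμ : KreinFeller.IsNonatomicProb μ) :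
    -- the eigenvalues are enumerated in increasing order, with the given eigenfunctions
    (StrictMono (KreinFeller.neumannEigenvalue μ) ∧
      range (KreinFeller.neumannEigenvalue μ) = KreinFeller.neumannSpectrum μ ∧
      ∀ m : ℕ, KreinFeller.IsNeumannEigenfunction μ
        (KreinFeller.neumannEigenvalue μ m) (KreinFeller.neumannEigenfunction μ m)) ∧
    (StrictMonoOn (KreinFeller.dirichletEigenvalue μ) (Ici 1) ∧
      KreinFeller.dirichletEigenvalue μ '' Ici 1 = KreinFeller.dirichletSpectrum μ ∧
      ∀ m : ℕ, 1 ≤ m → KreinFeller.IsDirichletEigenfunction μ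
        (KreinFeller.dirichletEigenvalue μ m) (KreinFeller.dirichletEigenfunction μ m)) ∧
    -- convergence of the Neumann eigenfunctions
    (∀ m : ℕ, ∃ c : ℝ≥0, 0 < c ∧
      ∀ μs : ℕ → Measure ℝ, (∀ n, KreinFeller.IsNonatomicProb (μs n)) →
        TendstoUniformlyOn (fun n => KreinFeller.distFun (μs n)) (KreinFeller.distFun μ)
          atTop (Icc 0 1) →
        TendstoUniformlyOn (fun n => KreinFeller.neumannEigenfunction (μs n) m)
          (KreinFeller.neumannEigenfunction μ m) atTop (Icc 0 1) ∧
        ∃ n₀ : ℕ, ∀ n ≥ n₀,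
          KreinFeller.supDist (KreinFeller.neumannEigenfunction μ m)
              (KreinFeller.neumannEigenfunction (μs n) m) ≤
            c * KreinFeller.supDist (KreinFeller.distFun μ) (KreinFeller.distFun (μs n))) ∧
    -- convergence of the Dirichlet eigenfunctions
    (∀ m : ℕ, 1 ≤ m → ∃ c : ℝ≥0, 0 < c ∧
      ∀ μs : ℕ → Measure ℝ, (∀ n, KreinFeller.IsNonatomicProb (μs n)) →
        TendstoUniformlyOn (fun n => KreinFeller.distFun (μs n)) (KreinFeller.distFun μ)
          atTop (Icc 0 1) →
        TendstoUniformlyOn (fun n => KreinFeller.dirichletEigenfunction (μs n) m)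
          (KreinFeller.dirichletEigenfunction μ m) atTop (Icc 0 1) ∧
        ∃ n₀ : ℕ, ∀ n ≥ n₀,
          KreinFeller.supDist (KreinFeller.dirichletEigenfunction μ m)
              (KreinFeller.dirichletEigenfunction (μs n) m) ≤
            c * KreinFeller.supDist (KreinFeller.distFun μ) (KreinFeller.distFun (μs n))) := by
  have hN := KreinFeller.isCharFun_neumann
  have hD := KreinFeller.isCharFun_dirichlet
  refine ⟨⟨?_, ?_, fun m => ?_⟩, ⟨?_, ?_, fun m _ => ?_⟩, fun m => ?_, fun m _ => ?_⟩
  · rw [funext (KreinFeller.neumannEigenvalue_eq hμ)]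
    exact KreinFeller.strictMono_nthSmallest (hN.infinite μ hμ) (hN.finite_Iic hμ)
  · rw [funext (KreinFeller.neumannEigenvalue_eq hμ), KreinFeller.neumannSpectrum_eq hμ]
    exact KreinFeller.range_nthSmallest (hN.infinite μ hμ) (hN.finite_Iic hμ)
  · refine KreinFeller.isNeumannEigenfunction_of hμ one_ne_zero ?_ fun x hx => by
      rw [one_mul, KreinFeller.neumannEigenfunction_eq hμ m hx]
    rw [KreinFeller.neumannEigenvalue_eq hμ]
    exact hN.nthSmallest_mem hμ m
  · intro i hi j hj hij
    rw [KreinFeller.dirichletEigenvalue_eq hμ, KreinFeller.dirichletEigenvalue_eq hμ]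
    rw [mem_Ici] at hi hj
    exact KreinFeller.strictMono_nthSmallest (hD.infinite μ hμ) (hD.finite_Iic hμ) (by omega)
  · rw [KreinFeller.dirichletSpectrum_eq hμ,
      ← KreinFeller.range_nthSmallest (hD.infinite μ hμ) (hD.finite_Iic hμ)]
    ext l
    constructor
    -- Dirichlet eigenvalues are counted from 1 and `nthSmallest` from 0, hence the index shift.
    · rintro ⟨m, -, rfl⟩
      exact ⟨m - 1, (KreinFeller.dirichletEigenvalue_eq hμ m).symm⟩
    · rintro ⟨m, rfl⟩
      exact ⟨m + 1, by simp, KreinFeller.dirichletEigenvalue_eq hμ (m + 1)⟩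
  · refine KreinFeller.isDirichletEigenfunction_of hμ
      (Real.sqrt_pos.2 (KreinFeller.dirichletEigenvalue_pos hμ m)).ne' ?_ fun x hx =>
      KreinFeller.dirichletEigenfunction_eq hμ m hx
    rw [KreinFeller.dirichletEigenvalue_eq hμ]
    exact hD.nthSmallest_mem hμ (m - 1)
  · obtain ⟨c, hc, d₀, hd₀, H⟩ := KreinFeller.neumannEigenfunction_lipschitz hμ m
    exact ⟨c.toNNReal, Real.toNNReal_pos.2 hc, fun μs hμs hF =>
      KreinFeller.convergence_of_lipschitz hc hd₀ hF fun n => H (μs n) (hμs n)⟩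
  · obtain ⟨c, hc, d₀, hd₀, H⟩ := KreinFeller.dirichletEigenfunction_lipschitz hμ m
    exact ⟨c.toNNReal, Real.toNNReal_pos.2 hc, fun μs hμs hF =>
      KreinFeller.convergence_of_lipschitz hc hd₀ hF fun n => H (μs n) (hμs n)⟩
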